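/- There exist universal constants $d_1,d_2>0$ such that the following holds. Let $m,N,s\ge 2$ be integers, $K\in\mathbb R$ and $0<\delta,\eta<1$. For an $m\times N$ complex matrix $A$, let $\delta_s(A)$ be its $s$-th restricted isometry constant, i.e. the smallest $\kappa\ge 0$ such that $(1-\kappa)\|x\|_2^2\le\|Ax\|_2^2\le(1+\kappa)\|x\|_2^2$ for all $x\in\mathbb C^N$ with at most $s$ nonzero entries. Assume that $$m\ \ge\ sK^2\delta^{-2}\max\{d_1\log^2 s\,\log m\,\log N,\ d_2\log(\eta^{-1})\}.$$ (i) Let $X_1,\dots,X_m$ be independent random vectors in $\mathbb C^N$ such that $$\frac1m\sum_{i=1}^m\mathbb E|\langle X_i,x\rangle|^2=\|x\|_2^2\quad\text{for all }x\in\mathbb C^N,\qquad \max_{1\le i\le m}\|X_i\|_\infty\le K\ \text{ almost surely},$$ and let $A$ be the $m\times N$ random matrix with rows $\frac1{\sqrt m}X_1,\dots,\frac1{\sqrt m}X_m$. Then $\mathbb P(\delta_s(A)\ge\delta)\le\eta$. (ii) In particular, let $\nu$ be a probability measure on a measurable space $D$, let $\phi_1,\dots,\phi_N:D\to\mathbb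 C$ be measurable functions that are orthonormal in $L^2(\nu)$ with $|\phi_j|\le K$ $\nu$-almost everywhere for every $j$, let $t_1,\dots,t_m$ be independent $D$-valued random variables with law $\nu$, and let $A=\big(\frac1{\sqrt m}\phi_j(t_i)\big)_{i\le m,\,j\le N}$. Then $\mathbb P(\delta_s(A)\ge\delta)\le\eta$. -/

import Mathlib

open MeasureTheory ProbabilityTheory
open scoped Matrix

/-- `delta` satisfies the two restricted isometry inequalities of order `s` for the matrix `A`:
`(1 - delta) ‖x‖₂² ≤ ‖A x‖₂² ≤ (1 + delta) ‖x‖₂²` for all `x` in complex `N`-space with at most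
`s` nonzero coordinates (`hammingNorm` counts nonzero coordinates). -/
def RIPBound {m N : ℕ} (s : ℕ) (A : Matrix (Fin m) (Fin N) ℂ) (delta : ℝ) : Prop :=
  ∀ x : EuclideanSpace ℂ (Fin N), hammingNorm x.ofLp ≤ s →
    (1 - delta) * ‖x‖ ^ 2 ≤ ‖WithLp.toLp 2 (A *ᵥ x.ofLp)‖ ^ 2 ∧
      ‖WithLp.toLp 2 (A *ᵥ x.ofLp)‖ ^ 2 ≤ (1 + delta) * ‖x‖ ^ 2

/-- The `s`-th restricted isometry constant of `A`: the smallest `delta ≥ 0` for which the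
restricted isometry inequalities of order `s` hold. -/
noncomputable def ricConst {m N : ℕ} (s : ℕ) (A : Matrix (Fin m) (Fin N) ℂ) : ℝ :=
  sInf {delta : ℝ | 0 ≤ delta ∧ RIPBound s A delta}

/-- The infimum in the definition of the restricted isometry constant is a minimum. -/
theorem ricConst_isLeast {m N : ℕ} (s : ℕ) (A : Matrix (Fin m) (Fin N) ℂ) :
    IsLeast {delta : ℝ | 0 ≤ delta ∧ RIPBound s A delta} (ricConst s A) := by
  have hbdd : BddBelow {delta : ℝ | 0 ≤ delta ∧ RIPBound s A delta} := ⟨0, fun d hd => hd.1⟩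
  refine ⟨IsClosed.csInf_mem ?_ ?_ hbdd, fun d hd => csInf_le hbdd hd⟩
  · simp only [RIPBound, Set.ofPred_and, Set.ofPred_forall]
    refine IsClosed.inter isClosed_Ici (isClosed_iInter fun x => isClosed_iInter fun _ => ?_)
    exact (isClosed_le (by fun_prop) (by fun_prop)).inter (isClosed_le (by fun_prop) (by fun_prop))
  · let T : EuclideanSpace ℂ (Fin N) →L[ℂ] EuclideanSpace ℂ (Fin m) :=
      LinearMap.toContinuousLinearMap (Matrix.toEuclideanLin A)
    refine ⟨1 + ‖T‖ ^ 2, by positivity, fun x _ => ?_⟩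
    have hT : ‖WithLp.toLp 2 (A *ᵥ x.ofLp)‖ ≤ ‖T‖ * ‖x‖ := T.le_opNorm x
    have h2 : ‖WithLp.toLp 2 (A *ᵥ x.ofLp)‖ ^ 2 ≤ (‖T‖ * ‖x‖) ^ 2 := by gcongr
    have h3 : 0 ≤ ‖T‖ ^ 2 * ‖x‖ ^ 2 := by positivity
    constructor
    · nlinarith [sq_nonneg ‖WithLp.toLp 2 (A *ᵥ x.ofLp)‖]
    · nlinarith [sq_nonneg ‖x‖]

/-- The `m × N` matrix with rows `v 1 / √m, …, v m / √m`. -/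
noncomputable def normalizedRows {m N : ℕ} (v : Fin m → EuclideanSpace ℂ (Fin N)) :
    Matrix (Fin m) (Fin N) ℂ :=
  Matrix.of fun i j => (1 / (Real.sqrt m : ℂ)) * v i j

/-- The condition
`m ≥ s K² δ⁻² max {d₁ log² s · log m · log N, d₂ log (η⁻¹)}` on the number of rows. -/
def SampleCondition (d₁ d₂ : ℝ) (m N s : ℕ) (K delta eta : ℝ) : Prop :=
  (s : ℝ) * K ^ 2 * (delta ^ 2)⁻¹ *
      max (d₁ * Real.log s ^ 2 * Real.log m * Real.log N) (d₂ * Real.log eta⁻¹) ≤ (m : ℝ)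

/-- `φ 1, …, φ N` is a bounded orthonormal system with constant `K` for the measure `ν`:
orthonormal in complex `L²(ν)` and uniformly bounded by `K` (up to `ν`-null sets). -/
structure IsBoundedOrthonormalSystem {D : Type*} [MeasurableSpace D] (ν : Measure D) {N : ℕ}
    (φ : Fin N → D → ℂ) (K : ℝ) : Prop where
  measurable : ∀ j, Measurable (φ j)
  orthonormal : ∀ j k, ∫ t, φ j t * starRingEnd ℂ (φ k t) ∂ν = if j = k then 1 else 0
  bounded : ∀ j, ∀ᵐ t ∂ν, ‖φ j t‖ ≤ K

/-! The restricted isometry deviation is the supremum, over sparse unit-ball vectors `x`, of the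
empirical process `∑ |⟨X i, x⟩|² - m‖x‖²`. A fine finite ℓ₁-net reduces it to a finite maximum `D`
(`exists_sparse_net`, `ricConst_lt_of_deviation_lt`), and symmetrization (`integral_radSup_le`)
replaces its moments by those of a Rademacher process with the rows fixed.

The Rademacher process is handled by chaining. Put `H² = m + D`, which bounds `∑ |⟨v i, x⟩|²` on the
net. If all `⟨v i, x⟩` and `⟨v i, y⟩` differ by at most `u`, the increment has variance at most
`(2Hu)²`. A sparse unit-ball vector has ℓ₁-norm at most `√s`, so Maurey's empirical method
(`exists_vertex_tuple`) covers at scale `u ≈ √s K 2⁻ᵏ` with log-cardinality of order `4ᵏ log m log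
N`. Hence each scale contributes order `H √s K √(log m log N)`, the same for all `k`. After about
`log s` scales one has `4ᵏ ≥ s`, and the log-cardinality `≈ s log m log N` of the whole net is no
longer too large. This yields the `p`-th moment bound `H √s K (√p + log s √(log m log N))` of
`radMomentLE_sparse`, up to a constant.

As `H` contains `D` itself, the result is the self-bounding inequality `E D^(2r) ≤ (β m)^r E (m +
D)^r` with small `β`, which is solved for `E D^(2r)` (`integral_deviation_pow_le`). Markov's
inequality with `r ≈ log η⁻¹` finishes. A bounded orthonormal system is the special case in which
every row is isotropic. -/

/-- The sign `1` or `-1` encoded by a Boolean. -/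
def boolSign (b : Bool) : ℝ := if b then 1 else -1

lemma abs_boolSign (b : Bool) : |boolSign b| = 1 := by cases b <;> simp [boolSign]

/-! ### Moments of Rademacher sums and of their maxima -/

section Rademacher

variable {κ : Type*} [Fintype κ]

/-- The Rademacher sum `∑ ε i * a i`. -/
def radSum (ε : κ → Bool) (a : κ → ℝ) : ℝ := ∑ i, boolSign (ε i) * a i

lemma radSum_sub (ε : κ → Bool) (a b : κ → ℝ) : radSum ε (a - b) = radSum ε a - radSum ε b := by
  simp [radSum, mul_sub, Finset.sum_sub_distrib]

lemma abs_radSum_le_iSup {ι : Type*} [Finite ι] (ε : κ → Bool) (a : ι → κ → ℝ) (j : ι) :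
    |radSum ε (a j)| ≤ ⨆ j, |radSum ε (a j)| :=
  le_ciSup (f := fun j => |radSum ε (a j)|) (Set.finite_range _).bddAbove j

lemma iSup_abs_radSum_nonneg {ι : Type*} (ε : κ → Bool) (a : ι → κ → ℝ) : 0 ≤ ⨆ j, |radSum ε (a j)| :=
  Real.iSup_nonneg fun _ => abs_nonneg _

variable [DecidableEq κ]

/-- The average over all choices of signs. -/
noncomputable def radAvg (F : (κ → Bool) → ℝ) : ℝ :=
  ∑ ε, ((2 : ℝ) ^ Fintype.card κ)⁻¹ * F ε

lemma sum_radAvg_weights : ∑ _ε : κ → Bool, ((2 : ℝ) ^ Fintype.card κ)⁻¹ = 1 := by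
  simp [Finset.card_univ]

lemma radAvg_mono {F G : (κ → Bool) → ℝ} (h : ∀ ε, F ε ≤ G ε) : radAvg F ≤ radAvg G :=
  Finset.sum_le_sum fun ε _ => mul_le_mul_of_nonneg_left (h ε) (by positivity)

lemma radAvg_nonneg {F : (κ → Bool) → ℝ} (h : ∀ ε, 0 ≤ F ε) : 0 ≤ radAvg F :=
  Finset.sum_nonneg fun ε _ => mul_nonneg (by positivity) (h ε)

lemma radAvg_add (F G : (κ → Bool) → ℝ) :
    radAvg (fun ε => F ε + G ε) = radAvg F + radAvg G := by
  simp [radAvg, mul_add, Finset.sum_add_distrib]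

lemma radAvg_const_mul (c : ℝ) (F : (κ → Bool) → ℝ) :
    radAvg (fun ε => c * F ε) = c * radAvg F := by
  simp only [radAvg, Finset.mul_sum]
  exact Finset.sum_congr rfl fun _ _ => by ring

lemma radAvg_sum {ι : Type*} (s : Finset ι) (F : ι → (κ → Bool) → ℝ) :
    radAvg (fun ε => ∑ j ∈ s, F j ε) = ∑ j ∈ s, radAvg (F j) := by
  simp only [radAvg, Finset.mul_sum]
  exact Finset.sum_comm

lemma radAvg_pow_le {F : (κ → Bool) → ℝ} (h : ∀ ε, 0 ≤ F ε) (n : ℕ) :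
    radAvg F ^ n ≤ radAvg (fun ε => F ε ^ n) :=
  Real.pow_arith_mean_le_arith_mean_pow Finset.univ _ _ (fun _ _ => by positivity)
    sum_radAvg_weights (fun ε _ => h ε) n

lemma radAvg_exp_radSum (a : κ → ℝ) (t : ℝ) :
    radAvg (fun ε => Real.exp (t * radSum ε a)) = ∏ i, Real.cosh (t * a i) := by
  have h1 : ∀ i, Real.cosh (t * a i) = ∑ b : Bool, (2 : ℝ)⁻¹ * Real.exp (t * (boolSign b * a i)) := by
    intro i
    rw [Real.cosh_eq]
    simp [boolSign]
    ring
  simp_rw [h1]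
  rw [Finset.prod_univ_sum]
  simp only [Fintype.piFinset_univ, radAvg]
  refine Finset.sum_congr rfl fun ε _ => ?_
  rw [Finset.prod_mul_distrib, ← Real.exp_sum, radSum, Finset.mul_sum]
  simp [Finset.card_univ]

lemma radAvg_exp_radSum_le (a : κ → ℝ) (t : ℝ) :
    radAvg (fun ε => Real.exp (t * radSum ε a)) ≤ Real.exp (t ^ 2 * (∑ i, a i ^ 2) / 2) := by
  rw [radAvg_exp_radSum]
  calc ∏ i, Real.cosh (t * a i) ≤ ∏ i, Real.exp ((t * a i) ^ 2 / 2) :=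
        Finset.prod_le_prod (fun i _ => (Real.cosh_pos _).le)
          fun i _ => Real.cosh_le_exp_half_sq _
    _ = _ := by
        rw [← Real.exp_sum]
        congr 1
        rw [Finset.mul_sum, Finset.sum_div]
        exact Finset.sum_congr rfl fun _ _ => by ring

/-- Khintchine's inequality for even moments. -/
lemma radAvg_radSum_pow_le (a : κ → ℝ) {σ : ℝ} (hσ : 0 < σ) (ha : ∑ i, a i ^ 2 ≤ σ ^ 2)
    {r : ℕ} (hr : 1 ≤ r) :
    radAvg (fun ε => |radSum ε a| ^ (2 * r)) ≤ (4 * σ * √(2 * r)) ^ (2 * r) := by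
  set q : ℝ := 2 * r with hq
  have hr' : (1 : ℝ) ≤ r := by exact_mod_cast hr
  have hq0 : 0 < q := by positivity
  have hsq : √q ^ 2 = q := Real.sq_sqrt hq0.le
  have hsq0 : 0 < √q := Real.sqrt_pos.2 hq0
  -- This value nearly optimizes the comparison of the power with `cosh`: the variance factor
  -- becomes `exp (t²σ²/2) = exp r`, and `(2r)! / t^(2r)` is at most `(σ√q)^(2r)`.
  set t : ℝ := √q / σ with ht
  have ht0 : 0 < t := by positivity
  have key : ∀ ε : κ → Bool, |radSum ε a| ^ (2 * r) ≤ ((2 * r).factorial / t ^ (2 * r)) *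
      (Real.exp (t * radSum ε a) + Real.exp (-t * radSum ε a)) := by
    intro ε
    have h1 := Real.pow_div_factorial_le_exp (t * |radSum ε a|) (by positivity) (2 * r)
    have h2 : Real.exp (t * |radSum ε a|) ≤
        Real.exp (t * radSum ε a) + Real.exp (-t * radSum ε a) := by
      rcases abs_cases (radSum ε a) with ⟨h, _⟩ | ⟨h, _⟩ <;> rw [h]
      · linarith [Real.exp_pos (-t * radSum ε a)]
      · have : t * -radSum ε a = -t * radSum ε a := by ring
        rw [this]
        linarith [Real.exp_pos (t * radSum ε a)]
    have h3 := h1.trans h2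
    rw [mul_pow, div_le_iff₀ (by positivity)] at h3
    rw [div_mul_eq_mul_div, le_div_iff₀ (by positivity)]
    linarith
  have hexp : ∀ u : ℝ, u ^ 2 = t ^ 2 → radAvg (fun ε => Real.exp (u * radSum ε a)) ≤
      Real.exp r := by
    intro u hu
    refine (radAvg_exp_radSum_le a u).trans (Real.exp_le_exp.2 ?_)
    rw [hu, ht, div_pow, hsq, div_mul_eq_mul_div, div_div, div_le_iff₀ (by positivity)]
    rw [hq]
    nlinarith
  have hfac : ((2 * r).factorial : ℝ) ≤ q ^ (2 * r) := by
    rw [hq]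
    exact_mod_cast Nat.factorial_le_pow (2 * r)
  have he : 2 * Real.exp r ≤ 4 ^ (2 * r) := by
    have h1 : Real.exp r = Real.exp 1 ^ r := by rw [← Real.exp_nat_mul, mul_one]
    have h2 : Real.exp 1 ^ r ≤ 3 ^ r := pow_le_pow_left₀ (Real.exp_pos _).le
      (by linarith [Real.exp_one_lt_d9]) r
    have h3 : (2 : ℝ) ≤ 2 ^ r := by
      simpa using pow_le_pow_right₀ (by norm_num : (1 : ℝ) ≤ 2) hr
    calc 2 * Real.exp r ≤ 2 ^ r * 3 ^ r := by
          rw [h1]; exact mul_le_mul h3 h2 (by positivity) (by positivity)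
      _ = 6 ^ r := by rw [← mul_pow]; norm_num
      _ ≤ 16 ^ r := by gcongr; norm_num
      _ = 4 ^ (2 * r) := by rw [pow_mul]; norm_num
  calc radAvg (fun ε => |radSum ε a| ^ (2 * r))
      ≤ ((2 * r).factorial / t ^ (2 * r)) * (Real.exp r + Real.exp r) := by
        refine (radAvg_mono key).trans ?_
        rw [radAvg_const_mul, radAvg_add]
        gcongr
        · exact hexp t rfl
        · exact hexp (-t) (by ring)
    _ ≤ (q ^ (2 * r) / t ^ (2 * r)) * 4 ^ (2 * r) := by
        rw [← two_mul]
        gcongr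
    _ = (4 * σ * √q) ^ (2 * r) := by
        rw [← div_pow, ← mul_pow]
        congr 1
        nth_rw 1 [ht, ← hsq]
        field_simp

/-- The `p`-th moment of the largest of the Rademacher sums with coefficients `a j` is at most
`W ^ p`. -/
def RadMomentLE {ι : Type*} (p : ℕ) (a : ι → κ → ℝ) (W : ℝ) : Prop :=
  radAvg (fun ε => (⨆ j, |radSum ε (a j)|) ^ p) ≤ W ^ p

/-- Minkowski's inequality for two summands, with bounds on the moments instead of norms. -/
lemma radAvg_add_pow_le {F G : (κ → Bool) → ℝ} {p : ℕ} {V W : ℝ} (hF : ∀ ε, 0 ≤ F ε)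
    (hG : ∀ ε, 0 ≤ G ε) (hV : 0 < V) (hW : 0 < W) (h1 : radAvg (fun ε => F ε ^ p) ≤ V ^ p)
    (h2 : radAvg (fun ε => G ε ^ p) ≤ W ^ p) :
    radAvg (fun ε => (F ε + G ε) ^ p) ≤ (V + W) ^ p := by
  -- Convexity of the power at `F/V` and `G/W`, with weights proportional to `V` and `W`, makes the
  -- two moment hypotheses add up exactly to `(V + W)^p`.
  have key : ∀ ε, (F ε + G ε) ^ p ≤ (V + W) ^ p * (V / (V + W) * (V ^ p)⁻¹) * F ε ^ p +
      (V + W) ^ p * (W / (V + W) * (W ^ p)⁻¹) * G ε ^ p := by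
    intro ε
    have h := (convexOn_pow (𝕜 := ℝ) p).2
      (Set.mem_Ici.2 (div_nonneg (hF ε) hV.le)) (Set.mem_Ici.2 (div_nonneg (hG ε) hW.le))
      (show 0 ≤ V / (V + W) by positivity) (show 0 ≤ W / (V + W) by positivity) (by field_simp)
    simp only [smul_eq_mul] at h
    have e1 : F ε + G ε = (V + W) * (V / (V + W) * (F ε / V) + W / (V + W) * (G ε / W)) := by
      field_simp
    rw [e1, mul_pow]
    refine (mul_le_mul_of_nonneg_left h (by positivity)).trans (le_of_eq ?_)
    simp only [div_pow]
    field_simp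
  refine (radAvg_mono key).trans ?_
  rw [radAvg_add, radAvg_const_mul, radAvg_const_mul]
  calc _ ≤ (V + W) ^ p * (V / (V + W) * (V ^ p)⁻¹) * V ^ p +
      (V + W) ^ p * (W / (V + W) * (W ^ p)⁻¹) * W ^ p := by gcongr
    _ = (V + W) ^ p := by field_simp

variable {ι : Type*} [Fintype ι]

/-- A maximum is at most a sum, which costs a factor `card ι ≤ e^l` in the moment. Taken at an
exponent of order `p + l`, this factor is only a constant after extracting the root, and Khintchine
at that exponent gives `σ √(p + l)`. -/
lemma radMomentLE_of_card [Nonempty ι] {p : ℕ} (hp : 1 ≤ p) (a : ι → κ → ℝ) {σ l : ℝ}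
    (hσ : 0 < σ) (hl : 0 ≤ l) (ha : ∀ j, ∑ i, a j i ^ 2 ≤ σ ^ 2)
    (hcard : (Fintype.card ι : ℝ) ≤ Real.exp l) :
    RadMomentLE p a (24 * σ * √(p + l)) := by
  have hp' : (1 : ℝ) ≤ p := by exact_mod_cast hp
  -- The exponent `2pt` is a multiple of `p`, so Jensen applies to the `p`-th moment; it also
  -- satisfies `l ≤ pt ≤ 2(p + l)`.
  set t : ℕ := ⌈l / p⌉₊ + 1 with ht
  have ht1 : 1 ≤ t := by omega
  have hpt : 1 ≤ p * t := Nat.mul_pos hp ht1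
  have hlo : l ≤ p * t := by
    have := Nat.le_ceil (l / p)
    rw [div_le_iff₀ (by positivity)] at this
    rw [ht]; push_cast; nlinarith
  have hhi : (p * t : ℝ) ≤ 2 * (p + l) := by
    have := Nat.ceil_lt_add_one (a := l / p) (by positivity)
    have h2 : (p : ℝ) * (l / p) = l := by field_simp
    rw [ht]; push_cast; nlinarith
  set S : (κ → Bool) → ℝ := fun ε => ⨆ j, |radSum ε (a j)| with hS
  have hS0 : ∀ ε, 0 ≤ S ε := fun ε => iSup_abs_radSum_nonneg ε a
  have h1 : ∀ ε, (S ε ^ p) ^ (2 * t) ≤ ∑ j, |radSum ε (a j)| ^ (2 * (p * t)) := by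
    intro ε
    obtain ⟨j, hj⟩ := exists_eq_ciSup_of_finite (f := fun j => |radSum ε (a j)|)
    have : (S ε ^ p) ^ (2 * t) = |radSum ε (a j)| ^ (2 * (p * t)) := by
      rw [← pow_mul, hS]
      simp only at hj ⊢
      rw [← hj]
      congr 1
      ring
    rw [this]
    exact Finset.single_le_sum (f := fun j => |radSum ε (a j)| ^ (2 * (p * t)))
      (fun _ _ => by positivity) (Finset.mem_univ j)
  have h2 : radAvg (fun ε => S ε ^ p) ^ (2 * t) ≤ ((24 * σ * √(p + l)) ^ p) ^ (2 * t) := by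
    calc radAvg (fun ε => S ε ^ p) ^ (2 * t)
        ≤ radAvg (fun ε => (S ε ^ p) ^ (2 * t)) :=
          radAvg_pow_le (fun ε => pow_nonneg (hS0 ε) p) _
      _ ≤ radAvg (fun ε => ∑ j, |radSum ε (a j)| ^ (2 * (p * t))) := radAvg_mono h1
      _ = ∑ j, radAvg (fun ε => |radSum ε (a j)| ^ (2 * (p * t))) := radAvg_sum _ _
      _ ≤ ∑ _j : ι, (4 * σ * √(2 * (p * t : ℕ))) ^ (2 * (p * t)) :=
          Finset.sum_le_sum fun j _ => radAvg_radSum_pow_le (a j) hσ (ha j) hpt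
      _ = Fintype.card ι * (4 * σ * √(2 * (p * t : ℕ))) ^ (2 * (p * t)) := by
          simp [Finset.card_univ]
      _ ≤ 3 ^ (2 * (p * t)) * (4 * σ * √(4 * (p + l))) ^ (2 * (p * t)) := by
          have h4 : √(2 * (p * t : ℕ)) ≤ √(4 * (p + l)) :=
            Real.sqrt_le_sqrt (by push_cast; linarith)
          gcongr
          · refine hcard.trans ?_
            have : Real.exp l ≤ Real.exp (1 * (p * t : ℕ)) := Real.exp_le_exp.2 (by
              push_cast; linarith)
            refine this.trans ?_
            rw [mul_comm 1, Real.exp_nat_mul]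
            refine (pow_le_pow_left₀ (Real.exp_pos _).le
              (by linarith [Real.exp_one_lt_d9] : Real.exp 1 ≤ 3) _).trans ?_
            exact pow_le_pow_right₀ (by norm_num) (by omega)
      _ = ((24 * σ * √(p + l)) ^ p) ^ (2 * t) := by
          rw [← mul_pow, ← pow_mul, Real.sqrt_mul (by norm_num : (0 : ℝ) ≤ 4)]
          have : √(4 : ℝ) = 2 := by
            rw [show (4 : ℝ) = 2 ^ 2 by norm_num]; exact Real.sqrt_sq (by norm_num)
          rw [this]
          congr 1 <;> ring
  exact le_of_pow_le_pow_left₀ (by omega) (by positivity) h2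

/-- One step of the chaining argument. -/
lemma RadMomentLE.chain [Nonempty ι] {ι' : Type*} [Fintype ι'] {p : ℕ} (hp : 1 ≤ p)
    {a : ι → κ → ℝ} {b : ι' → κ → ℝ} {W σ l : ℝ} (hW : 0 < W) (hb : RadMomentLE p b W)
    (hσ : 0 < σ) (hl : 0 ≤ l) (hnet : ∀ j, ∃ k, ∑ i, (a j i - b k i) ^ 2 ≤ σ ^ 2)
    (hcard : (Fintype.card ι : ℝ) ≤ Real.exp l) :
    RadMomentLE p a (W + 24 * σ * √(p + l)) := by
  -- Each fine index is linked to a single coarse index, so the number of increments is the number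
  -- of fine indices, whatever the size of the coarse family.
  choose f hf using hnet
  have h2 : RadMomentLE p (fun j => a j - b (f j)) (24 * σ * √(p + l)) :=
    radMomentLE_of_card hp _ hσ hl hf hcard
  have hp' : (1 : ℝ) ≤ p := by exact_mod_cast hp
  have hs : 0 < 24 * σ * √(p + l) := by
    have : 0 < √((p : ℝ) + l) := Real.sqrt_pos.2 (by linarith)
    positivity
  refine le_trans (radAvg_mono fun ε => ?_)
    (radAvg_add_pow_le (fun ε => iSup_abs_radSum_nonneg ε _) (fun ε => iSup_abs_radSum_nonneg ε _)
      hW hs hb h2)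
  refine pow_le_pow_left₀ (iSup_abs_radSum_nonneg _ _) (ciSup_le fun j => ?_) p
  have e : radSum ε (a j) = radSum ε (b (f j)) + radSum ε (a j - b (f j)) := by
    rw [radSum_sub]; ring
  rw [e]
  exact (abs_add_le _ _).trans (add_le_add (abs_radSum_le_iSup ε b (f j))
    (abs_radSum_le_iSup ε (fun j => a j - b (f j)) j))

end Rademacher

/-! ### Maurey's empirical method -/

/-- Hoeffding's lemma for a finitely supported centred random variable. -/
lemma sum_mul_exp_le {V : Type*} [Fintype V] {p y : V → ℝ} {B : ℝ} (hp : ∀ v, 0 ≤ p v)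
    (hp1 : ∑ v, p v = 1) (hy : ∑ v, p v * y v = 0) (hB : 0 < B) (hyB : ∀ v, |y v| ≤ B) (t : ℝ) :
    ∑ v, p v * Real.exp (t * y v) ≤ Real.exp ((t * B) ^ 2 / 2) := by
  -- The chord of the exponential over `[-tB, tB]` lies above it; its linear term averages to zero
  -- and leaves `cosh (t * B)`.
  have key : ∀ v, Real.exp (t * y v) ≤
      Real.cosh (t * B) + y v * (Real.sinh (t * B) / B) := by
    intro v
    obtain ⟨h1, h2⟩ := abs_le.1 (hyB v)
    have h := convexOn_exp.2 (Set.mem_univ (t * B)) (Set.mem_univ (-(t * B)))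
      (show 0 ≤ (B + y v) / (2 * B) from div_nonneg (by linarith) (by linarith))
      (show 0 ≤ (B - y v) / (2 * B) from div_nonneg (by linarith) (by linarith))
      (by field_simp; ring)
    simp only [smul_eq_mul] at h
    have e : (B + y v) / (2 * B) * (t * B) + (B - y v) / (2 * B) * -(t * B) = t * y v := by
      field_simp; ring
    rw [e] at h
    refine h.trans (le_of_eq ?_)
    rw [Real.cosh_eq, Real.sinh_eq]
    field_simp
    ring
  calc ∑ v, p v * Real.exp (t * y v)
      ≤ ∑ v, p v * (Real.cosh (t * B) + y v * (Real.sinh (t * B) / B)) :=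
        Finset.sum_le_sum fun v _ => mul_le_mul_of_nonneg_left (key v) (hp v)
    _ = Real.cosh (t * B) := by
        simp_rw [mul_add, ← mul_assoc]
        rw [Finset.sum_add_distrib, ← Finset.sum_mul, ← Finset.sum_mul, hp1, hy]
        ring
    _ ≤ _ := Real.cosh_le_exp_half_sq _

lemma exists_le_of_weighted_sum_le {V : Type*} [Fintype V] {p f : V → ℝ} {c : ℝ}
    (hp : ∀ v, 0 ≤ p v) (hp1 : ∑ v, p v = 1) (h : ∑ v, p v * f v ≤ c) : ∃ v, f v ≤ c := by
  by_contra! hc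
  obtain ⟨v, hv⟩ : ∃ v, p v ≠ 0 := by
    by_contra! h0
    simp [h0] at hp1
  have : ∑ v, p v * c < ∑ v, p v * f v :=
    Finset.sum_lt_sum (fun v _ => mul_le_mul_of_nonneg_left (hc v).le (hp v))
      ⟨v, Finset.mem_univ v, mul_lt_mul_of_pos_left (hc v) (lt_of_le_of_ne (hp v) hv.symm)⟩
  rw [← Finset.sum_mul, hp1] at this
  linarith

/-- Method of conditional expectations: given the entries already chosen, some next entry makes the
exponential potential at most its `p`-average, which grows by at most the Hoeffding factor. No
product measure on tuples is needed. -/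
lemma exists_tuple_sum_exp_le {V R : Type*} [Fintype V] [Fintype R] {p : V → ℝ} {h : R → V → ℝ}
    {B : ℝ} (hp : ∀ v, 0 ≤ p v) (hp1 : ∑ v, p v = 1) (hh : ∀ r, ∑ v, p v * h r v = 0)
    (hB : 0 < B) (hhB : ∀ r v, |h r v| ≤ B) (t : ℝ) (n : ℕ) :
    ∃ τ : Fin n → V, ∑ r, Real.exp (t * ∑ l, h r (τ l)) ≤
      Fintype.card R * Real.exp (n * ((t * B) ^ 2 / 2)) := by
  induction n with
  | zero => exact ⟨Fin.elim0, by simp [Finset.card_univ]⟩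
  | succ n ih =>
    obtain ⟨τ, hτ⟩ := ih
    obtain ⟨v, hv⟩ : ∃ v, ∑ r, Real.exp (t * ∑ l, h r (τ l)) * Real.exp (t * h r v) ≤
        Fintype.card R * Real.exp (n * ((t * B) ^ 2 / 2)) * Real.exp ((t * B) ^ 2 / 2) := by
      refine exists_le_of_weighted_sum_le hp hp1 ?_
      have hcomm : ∀ F : R → V → ℝ, ∑ v, p v * ∑ r, F r v = ∑ r, ∑ v, p v * F r v := fun F => by
        simp_rw [Finset.mul_sum]
        exact Finset.sum_comm
      rw [hcomm]
      calc ∑ r, ∑ v, p v * (Real.exp (t * ∑ l, h r (τ l)) * Real.exp (t * h r v))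
          = ∑ r, Real.exp (t * ∑ l, h r (τ l)) * ∑ v, p v * Real.exp (t * h r v) := by
            refine Finset.sum_congr rfl fun r _ => ?_
            rw [Finset.mul_sum _ (fun v => p v * Real.exp (t * h r v))]
            exact Finset.sum_congr rfl fun _ _ => by ring
        _ ≤ ∑ r, Real.exp (t * ∑ l, h r (τ l)) * Real.exp ((t * B) ^ 2 / 2) := by
            gcongr with r
            exact sum_mul_exp_le hp hp1 (hh r) hB (hhB r) t
        _ ≤ _ := by
            rw [← Finset.sum_mul]
            exact mul_le_mul_of_nonneg_right hτ (Real.exp_pos _).le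
    refine ⟨Fin.cons v τ, ?_⟩
    simp only [Fin.sum_univ_succ, Fin.cons_zero, Fin.cons_succ]
    calc ∑ r, Real.exp (t * (h r v + ∑ l, h r (τ l)))
        = ∑ r, Real.exp (t * ∑ l, h r (τ l)) * Real.exp (t * h r v) :=
          Finset.sum_congr rfl fun r _ => by rw [← Real.exp_add]; ring_nf
      _ ≤ _ := hv
      _ = _ := by
          rw [mul_assoc, ← Real.exp_add]
          push_cast
          ring_nf

/-- The empirical method of Maurey: a convex combination of points is close to an average of
few of these points, simultaneously for finitely many functionals. -/
lemma exists_tuple_approx {V R : Type*} [Fintype V] [Fintype R] {p : V → ℝ} {g : R → V → ℝ}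
    {b θ : ℝ} {n : ℕ} (hp : ∀ v, 0 ≤ p v) (hp1 : ∑ v, p v = 1) (hb : 0 < b)
    (hgb : ∀ r v, |g r v| ≤ b) (hθ : 0 < θ) (hn : Real.log (Fintype.card R) ≤ n * θ ^ 2) :
    ∃ τ : Fin n → V, ∀ r, ∑ l, g r (τ l) - n * ∑ v, p v * g r v ≤ 3 * θ * b * n := by
  set M : R → ℝ := fun r => ∑ v, p v * g r v with hM
  have hMb : ∀ r, |M r| ≤ b := by
    intro r
    calc |M r| ≤ ∑ v, |p v * g r v| := Finset.abs_sum_le_sum_abs _ _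
      _ ≤ ∑ v, p v * b := by
          gcongr with v
          rw [abs_mul, abs_of_nonneg (hp v)]
          exact mul_le_mul_of_nonneg_left (hgb r v) (hp v)
      _ = b := by rw [← Finset.sum_mul, hp1, one_mul]
  -- Centring doubles the bound to `2b`. With parameter `θ/b` the Hoeffding exponent is `2nθ²`;
  -- adding `log (card R) ≤ nθ²` gives the 3 in the conclusion.
  obtain ⟨τ, hτ⟩ := exists_tuple_sum_exp_le (h := fun r v => g r v - M r) (B := 2 * b) hp hp1
    (fun r => by
      simp only [mul_sub, Finset.sum_sub_distrib, ← Finset.sum_mul, hp1, one_mul]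
      simp [hM])
    (by positivity)
    (fun r v => by
      have := abs_sub (g r v) (M r)
      linarith [hgb r v, hMb r]) (θ / b) n
  refine ⟨τ, fun r => ?_⟩
  have hR : 0 < (Fintype.card R : ℝ) := by exact_mod_cast Fintype.card_pos_iff.2 ⟨r⟩
  have h1 := (Finset.single_le_sum (fun r _ => (Real.exp_pos _).le) (Finset.mem_univ r)).trans hτ
  rw [← Real.exp_log hR, ← Real.exp_add, Real.exp_le_exp] at h1
  simp only [Finset.sum_sub_distrib, Finset.sum_const, Finset.card_univ, Fintype.card_fin,
    nsmul_eq_mul] at h1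
  have e : (θ / b * (2 * b)) ^ 2 / 2 = 2 * θ ^ 2 := by field_simp
  rw [e, div_mul_eq_mul_div, div_le_iff₀ hb] at h1
  have h2 : θ * (∑ l, g r (τ l) - n * M r) ≤ θ * (3 * θ * b * n) := by
    nlinarith
  exact le_of_mul_le_mul_left h2 hθ

/-- The coefficients of a complex number along `1, I, -1, -I`. -/
noncomputable def quarterPart (z : ℂ) : Fin 4 → ℝ :=
  ![max z.re 0, max z.im 0, max (-z.re) 0, max (-z.im) 0]

lemma quarterPart_nonneg (z : ℂ) (c : Fin 4) : 0 ≤ quarterPart z c := by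
  fin_cases c <;> simp [quarterPart]

lemma sum_quarterPart_mul (z : ℂ) : ∑ c, (quarterPart z c : ℂ) * Complex.I ^ (c : ℕ) = z := by
  have h : ∀ x : ℝ, max x 0 - max (-x) 0 = x := fun x => by
    rcases le_total 0 x with h | h
    · rw [max_eq_left h, max_eq_right (by linarith)]; ring
    · rw [max_eq_right h, max_eq_left (by linarith)]; ring
  have hI3 : Complex.I ^ 3 = -Complex.I := by rw [pow_succ, Complex.I_sq]; ring
  rw [Fin.sum_univ_four]
  simp only [quarterPart]
  apply Complex.ext
  · simp [hI3, ← sub_eq_add_neg, h]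
  · simp [hI3, ← sub_eq_add_neg, h]

lemma sum_quarterPart_le (z : ℂ) : ∑ c, quarterPart z c ≤ 2 * ‖z‖ := by
  have h : ∀ x : ℝ, max x 0 + max (-x) 0 = |x| := fun x => by
    rcases le_total 0 x with h | h
    · rw [max_eq_left h, max_eq_right (by linarith), abs_of_nonneg h]; ring
    · rw [max_eq_right h, max_eq_left (by linarith), abs_of_nonpos h]; ring
  rw [Fin.sum_univ_four]
  have e : quarterPart z 0 + quarterPart z 1 + quarterPart z 2 + quarterPart z 3 =
      |z.re| + |z.im| := by
    rw [← h, ← h]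
    simp only [quarterPart, Matrix.cons_val]
    ring
  rw [e]
  linarith [Complex.abs_re_le_norm z, Complex.abs_im_le_norm z]

/-- The value at `v` of a vertex of the complex `ℓ₁`-ball of radius `2 * D` (or of its centre). -/
noncomputable def vertexValue {N : ℕ} (D : ℝ) (v : Fin N → ℂ) : Option (Fin N × Fin 4) → ℂ
  | none => 0
  | some (j, c) => (2 * D : ℝ) * Complex.I ^ (c : ℕ) * v j

/-- Covering of the `ℓ₁`-ball with respect to finitely many bounded functionals. -/
lemma exists_vertex_tuple {m N : ℕ} {K D θ : ℝ} (hK : 0 < K) (hD : 0 < D) (hθ : 0 < θ)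
    {v : Fin m → Fin N → ℂ} (hv : ∀ i j, ‖v i j‖ ≤ K) {n : ℕ} (hn1 : 1 ≤ n)
    (hn : Real.log (4 * m) ≤ n * θ ^ 2) {x : Fin N → ℂ} (hx : ∑ j, ‖x j‖ ≤ D) :
    ∃ τ : Fin n → Option (Fin N × Fin 4), ∀ i,
      ‖v i ⬝ᵥ x - (n : ℂ)⁻¹ * ∑ l, vertexValue D (v i) (τ l)‖ ≤ 12 * θ * (D * K) := by
  -- Since `|re| + |im| ≤ 2‖·‖`, radius `2 * D` suffices to write `x` as a convex combination of
  -- vertices; the unused mass sits at the centre `none`.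
  set p : Option (Fin N × Fin 4) → ℝ := fun a => a.elim
    (1 - ∑ q : Fin N × Fin 4, quarterPart (x q.1) q.2 / (2 * D))
    (fun q => quarterPart (x q.1) q.2 / (2 * D)) with hp
  have hp0 : ∀ a, 0 ≤ p a := by
    rintro (_ | q)
    · simp only [hp, Option.elim_none, sub_nonneg]
      rw [← Finset.sum_div, div_le_one (by positivity), Fintype.sum_prod_type]
      calc ∑ j, ∑ c, quarterPart (x j) c ≤ ∑ j, 2 * ‖x j‖ :=
            Finset.sum_le_sum fun j _ => sum_quarterPart_le _
        _ ≤ 2 * D := by rw [← Finset.mul_sum]; linarith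
    · exact div_nonneg (quarterPart_nonneg _ _) (by positivity)
  have hp1 : ∑ a, p a = 1 := by
    rw [Fintype.sum_option]; simp [hp]
  have hmean : ∀ i, ∑ a, (p a : ℂ) * vertexValue D (v i) a = v i ⬝ᵥ x := by
    intro i
    rw [Fintype.sum_option, Fintype.sum_prod_type]
    simp only [vertexValue, mul_zero, zero_add, dotProduct]
    refine Finset.sum_congr rfl fun j _ => ?_
    conv_rhs => rw [← sum_quarterPart_mul (x j), Finset.mul_sum]
    refine Finset.sum_congr rfl fun c _ => ?_
    have : (D : ℂ) ≠ 0 := by exact_mod_cast hD.ne'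
    simp only [hp, Option.elim_some]
    push_cast
    field_simp
  have hnorm : ∀ i a, ‖vertexValue D (v i) a‖ ≤ 2 * D * K := by
    rintro i (_ | ⟨j, c⟩)
    · simp only [vertexValue, norm_zero]; positivity
    · simp only [vertexValue, norm_mul, norm_pow, Complex.norm_I, one_pow, mul_one,
        Complex.norm_real, Real.norm_of_nonneg (by positivity : 0 ≤ 2 * D)]
      exact mul_le_mul_of_nonneg_left (hv i j) (by positivity)
  -- The approximation is one-sided, so for each row it is applied to four rotated real parts; these
  -- bound the real and imaginary parts from both sides.
  obtain ⟨τ, hτ⟩ := exists_tuple_approx (R := Fin m × Fin 4)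
    (g := fun r a => (Complex.I ^ (r.2 : ℕ) * vertexValue D (v r.1) a).re)
    (b := 2 * D * K) hp0 hp1 (by positivity)
    (fun r a => (Complex.abs_re_le_norm _).trans (by simpa using hnorm r.1 a)) hθ
    (n := n) (by simpa [mul_comm] using hn)
  refine ⟨τ, fun i => ?_⟩
  have hn0 : (0 : ℝ) < n := by exact_mod_cast hn1
  set z : ℂ := (n : ℂ) * (v i ⬝ᵥ x) - ∑ l, vertexValue D (v i) (τ l) with hz
  have h4 : ∀ c : Fin 4, -(Complex.I ^ (c : ℕ) * z).re ≤ 3 * θ * (2 * D * K) * n := by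
    intro c
    refine le_trans (le_of_eq ?_) (hτ (i, c))
    have e1 : ∑ a, p a * (Complex.I ^ (c : ℕ) * vertexValue D (v i) a).re =
        (Complex.I ^ (c : ℕ) * (v i ⬝ᵥ x)).re := by
      rw [← hmean i, Finset.mul_sum, Complex.re_sum]
      refine Finset.sum_congr rfl fun a _ => ?_
      rw [← Complex.re_ofReal_mul]
      congr 1; ring
    simp only [e1]
    rw [← Complex.re_sum, ← Finset.mul_sum, hz, mul_sub, Complex.sub_re, mul_left_comm]
    rw [show ((n : ℂ) * (Complex.I ^ (c : ℕ) * (v i ⬝ᵥ x))).re =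
      n * (Complex.I ^ (c : ℕ) * (v i ⬝ᵥ x)).re by
        rw [← Complex.ofReal_natCast, Complex.re_ofReal_mul]]
    ring
  have hI3 : Complex.I ^ 3 = -Complex.I := by rw [pow_succ, Complex.I_sq]; ring
  have hz' : ‖z‖ ≤ 2 * (3 * θ * (2 * D * K) * n) := by
    have a0 := h4 0
    have a1 := h4 1
    have a2 := h4 2
    have a3 := h4 3
    simp [hI3] at a0 a1 a2 a3
    refine (Complex.norm_le_abs_re_add_abs_im z).trans ?_
    have b1 : |z.re| ≤ 3 * θ * (2 * D * K) * n := abs_le.2 ⟨by linarith, by linarith⟩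
    have b2 : |z.im| ≤ 3 * θ * (2 * D * K) * n := abs_le.2 ⟨by linarith, by linarith⟩
    linarith
  have e : v i ⬝ᵥ x - (n : ℂ)⁻¹ * ∑ l, vertexValue D (v i) (τ l) = (n : ℂ)⁻¹ * z := by
    have : (n : ℂ) ≠ 0 := by exact_mod_cast hn0.ne'
    rw [hz]; field_simp
  rw [e, norm_mul, norm_inv, Complex.norm_natCast, inv_mul_le_iff₀ hn0]
  linarith

/-! ### Sparse vectors and their ℓ₁-nets -/

/-- The `s`-sparse vectors in the Euclidean unit ball. -/
def sparseBall (N s : ℕ) : Set (EuclideanSpace ℂ (Fin N)) :=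
  {x | hammingNorm x.ofLp ≤ s ∧ ‖x‖ ≤ 1}

lemma sum_norm_le_of_mem_sparseBall {N s : ℕ} {x : EuclideanSpace ℂ (Fin N)}
    (hx : x ∈ sparseBall N s) : ∑ j, ‖x j‖ ≤ √s := by
  classical
  obtain ⟨h1, h2⟩ := hx
  set S : Finset (Fin N) := {j | x j ≠ 0} with hS
  have hcard : (S.card : ℝ) ≤ s := by exact_mod_cast h1
  have e : ∑ j, ‖x j‖ = ∑ j ∈ S, ‖x j‖ := by
    symm
    refine Finset.sum_subset (Finset.subset_univ _) fun j _ hj => ?_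
    simpa [hS] using hj
  refine Real.le_sqrt_of_sq_le ?_
  calc (∑ j, ‖x j‖) ^ 2 ≤ S.card * ∑ j ∈ S, ‖x j‖ ^ 2 := by
        rw [e]; exact sq_sum_le_card_mul_sum_sq
    _ ≤ S.card * ∑ j, ‖x j‖ ^ 2 := by
        gcongr
        exact Finset.subset_univ _
    _ = S.card * ‖x‖ ^ 2 := by rw [EuclideanSpace.norm_sq_eq]
    _ ≤ s * 1 := by
        gcongr
        exact pow_le_one₀ (norm_nonneg _) h2
    _ = s := mul_one _

lemma norm_dotProduct_le {N : ℕ} {K : ℝ} {v : Fin N → ℂ} (hv : ∀ j, ‖v j‖ ≤ K) (x : Fin N → ℂ) :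
    ‖v ⬝ᵥ x‖ ≤ K * ∑ j, ‖x j‖ := by
  rw [dotProduct, Finset.mul_sum]
  refine (norm_sum_le _ _).trans (Finset.sum_le_sum fun j _ => ?_)
  rw [norm_mul]
  exact mul_le_mul_of_nonneg_right (hv j) (norm_nonneg _)

lemma exists_range_superset {N s : ℕ} (hN : 0 < N) (S : Finset (Fin N)) (hS : S.card ≤ s) :
    ∃ f : Fin s → Fin N, ∀ j ∈ S, ∃ l, f l = j := by
  obtain ⟨e⟩ : Nonempty (S ↪ Fin s) := Function.Embedding.nonempty_of_card_le (by simpa using hS)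
  refine ⟨Function.extend e Subtype.val fun _ => ⟨0, hN⟩, fun j hj => ⟨e ⟨j, hj⟩, ?_⟩⟩
  rw [e.injective.extend_apply]

lemma abs_sub_le_of_floor_eq {R a b : ℝ} (hR : 0 < R) (ha : -1 ≤ a) (hb : -1 ≤ b)
    (h : ⌊(a + 1) * R⌋₊ = ⌊(b + 1) * R⌋₊) : |a - b| ≤ 1 / R := by
  have h1 := Nat.floor_le (a := (a + 1) * R) (by nlinarith)
  have h2 := Nat.floor_le (a := (b + 1) * R) (by nlinarith)
  have h3 := Nat.lt_floor_add_one ((a + 1) * R)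
  have h4 := Nat.lt_floor_add_one ((b + 1) * R)
  rw [h] at h1 h3
  have e : |a - b| * R = |(a - b) * R| := by rw [abs_mul, abs_of_pos hR]
  rw [le_div_iff₀ hR, e, abs_le]
  constructor <;> nlinarith

/-- A finite net of the sparse unit ball for the `ℓ₁`-norm. -/
lemma exists_sparse_net {N s R : ℕ} (hN : 0 < N) (hR : 0 < R) :
    ∃ y : (Fin s → Fin N × Fin (2 * R + 1) × Fin (2 * R + 1)) → EuclideanSpace ℂ (Fin N),
      (∀ g, y g ∈ sparseBall N s) ∧
        ∀ x ∈ sparseBall N s, ∃ g, ∑ j, ‖x j - y g j‖ ≤ 2 * s / R := by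
  classical
  have hR' : (0 : ℝ) < R := by exact_mod_cast hR
  have hsupp : ∀ x : sparseBall N s, ∃ f : Fin s → Fin N, ∀ j, x.1 j ≠ 0 → ∃ l, f l = j := by
    rintro ⟨x, hx⟩
    obtain ⟨f, hf⟩ := exists_range_superset hN {j | x j ≠ 0} (s := s) hx.1
    exact ⟨f, fun j hj => hf j (by simpa using hj)⟩
  choose f hf using hsupp
  have hco : ∀ (x : sparseBall N s) j, ‖x.1 j‖ ≤ 1 := fun x j =>
    (PiLp.norm_apply_le x.1 j).trans x.2.2
  have hre : ∀ (x : sparseBall N s) j, |(x.1 j).re| ≤ 1 := fun x j =>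
    (Complex.abs_re_le_norm _).trans (hco x j)
  have him : ∀ (x : sparseBall N s) j, |(x.1 j).im| ≤ 1 := fun x j =>
    (Complex.abs_im_le_norm _).trans (hco x j)
  have hfl : ∀ a : ℝ, |a| ≤ 1 → ⌊(a + 1) * R⌋₊ < 2 * R + 1 := by
    intro a ha
    rw [Nat.lt_succ_iff]
    refine Nat.floor_le_of_le ?_
    push_cast
    have := (abs_le.1 ha).2
    nlinarith
  -- A label records `s` positions containing the support and the entries there, rounded to
  -- multiples of `1/R`. Positions may repeat, and `⌊(a+1)R⌋` takes the `2R + 1` values from 0 to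
  -- `2R`.
  let label : sparseBall N s → (Fin s → Fin N × Fin (2 * R + 1) × Fin (2 * R + 1)) :=
    fun x l => (f x l, ⟨_, hfl _ (hre x (f x l))⟩, ⟨_, hfl _ (him x (f x l))⟩)
  have : Nonempty (sparseBall N s) := ⟨⟨0, by simp [sparseBall]⟩⟩
  -- The net point of a label is a sparse vector carrying it, so net points lie in the ball; labels
  -- that do not occur receive an arbitrary member.
  refine ⟨fun g => (Function.invFun label g).1, fun g => (Function.invFun label g).2,
    fun x hx => ⟨label ⟨x, hx⟩, ?_⟩⟩
  set x' : sparseBall N s := ⟨x, hx⟩ with hx'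
  set y := Function.invFun label (label x') with hy
  have hlab : label y = label x' := Function.invFun_eq ⟨x', rfl⟩
  have hff : f y = f x' := funext fun l => congrArg Prod.fst (congrFun hlab l)
  have hd : ∀ l, ‖x (f x' l) - y.1 (f x' l)‖ ≤ 2 / R := by
    intro l
    have e1 := congrArg (fun q => (q.2.1 : ℕ)) (congrFun hlab l)
    have e2 := congrArg (fun q => (q.2.2 : ℕ)) (congrFun hlab l)
    simp only [label, hff] at e1 e2
    have a1 := abs_sub_le_of_floor_eq hR' (abs_le.1 (hre x' (f x' l))).1
      (abs_le.1 (hre y (f x' l))).1 e1.symm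
    have a2 := abs_sub_le_of_floor_eq hR' (abs_le.1 (him x' (f x' l))).1
      (abs_le.1 (him y (f x' l))).1 e2.symm
    refine (Complex.norm_le_abs_re_add_abs_im _).trans ?_
    rw [Complex.sub_re, Complex.sub_im]
    have : (2 : ℝ) / R = 1 / R + 1 / R := by ring
    linarith
  have e : ∑ j, ‖x j - y.1 j‖ = ∑ j ∈ Finset.univ.image (f x'), ‖x j - y.1 j‖ := by
    symm
    refine Finset.sum_subset (Finset.subset_univ _) fun j _ hj => ?_
    have h1 : x j = 0 := by
      by_contra h
      obtain ⟨l, hl⟩ := hf x' j h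
      exact hj (Finset.mem_image.2 ⟨l, Finset.mem_univ _, hl⟩)
    have h2 : y.1 j = 0 := by
      by_contra h
      obtain ⟨l, hl⟩ := hf y j h
      exact hj (Finset.mem_image.2 ⟨l, Finset.mem_univ _, hff ▸ hl⟩)
    simp [h1, h2]
  rw [e]
  calc ∑ j ∈ Finset.univ.image (f x'), ‖x j - y.1 j‖
      ≤ (Finset.univ.image (f x')).card • (2 / R : ℝ) := by
        refine Finset.sum_le_card_nsmul _ _ _ fun j hj => ?_
        obtain ⟨l, _, rfl⟩ := Finset.mem_image.1 hj
        exact hd l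
    _ ≤ s * (2 / R : ℝ) := by
        rw [nsmul_eq_mul]
        gcongr
        exact Finset.card_image_le.trans (by simp)
    _ = 2 * s / R := by ring

/-! ### Multiscale covers and chaining -/

lemma RadMomentLE.mono {κ ι : Type*} [Fintype κ] [DecidableEq κ] {p : ℕ} {a : ι → κ → ℝ}
    {V W : ℝ} (h : RadMomentLE p a V) (hV : 0 ≤ V) (hVW : V ≤ W) : RadMomentLE p a W :=
  h.trans (pow_le_pow_left₀ hV hVW p)

/-- The number of vertices averaged at scale `2 ^ (-k)`. -/
noncomputable def tupleLength (m k : ℕ) : ℕ := ⌈(4 : ℝ) ^ k * Real.log (4 * m)⌉₊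

/-- The labels of the balls of radius comparable to `2 ^ (-k)` in the covering of the sparse unit
ball. -/
abbrev CoverLabel (m N k : ℕ) : Type := Fin (tupleLength m k) → Option (Fin N × Fin 4)

lemma log_two_ge_half : (1 / 2 : ℝ) ≤ Real.log 2 := by linarith [Real.log_two_gt_d9]

lemma half_le_log {n : ℕ} (hn : 2 ≤ n) : (1 / 2 : ℝ) ≤ Real.log n :=
  log_two_ge_half.trans (Real.log_le_log (by norm_num) (by exact_mod_cast hn))

lemma log_le_mul_log {n k : ℕ} {x : ℝ} (hx : 0 < x) (h : x ≤ (n : ℝ) ^ k) :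
    Real.log x ≤ k * Real.log n := by
  rw [← Real.log_pow]
  exact Real.log_le_log hx h

lemma tupleLength_le {m : ℕ} (hm : 2 ≤ m) (k : ℕ) :
    (tupleLength m k : ℝ) ≤ 5 * 4 ^ k * Real.log m := by
  have hm' : (2 : ℝ) ≤ m := by exact_mod_cast hm
  have h1 : Real.log (4 * m) ≤ (3 : ℕ) * Real.log m :=
    log_le_mul_log (by positivity) (by nlinarith [mul_self_le_mul_self (by norm_num) hm'])
  have h2 : 0 ≤ Real.log (4 * m) := Real.log_nonneg (by linarith)
  have h3 := half_le_log hm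
  have h4 : (1 : ℝ) ≤ 4 ^ k := one_le_pow₀ (by norm_num)
  have := Nat.ceil_lt_add_one (a := (4 : ℝ) ^ k * Real.log (4 * m)) (by positivity)
  rw [tupleLength]
  push_cast at h1
  nlinarith

lemma card_coverLabel_le {m N : ℕ} (hm : 2 ≤ m) (hN : 2 ≤ N) (k : ℕ) :
    (Fintype.card (CoverLabel m N k) : ℝ) ≤
      Real.exp (20 * 4 ^ k * (Real.log m * Real.log N)) := by
  have hN' : (2 : ℝ) ≤ N := by exact_mod_cast hN
  have h1 : Real.log (4 * N + 1) ≤ (4 : ℕ) * Real.log N := by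
    refine log_le_mul_log (by positivity) ?_
    have : (8 : ℝ) ≤ N ^ 3 := by
      calc (8 : ℝ) = 2 ^ 3 := by norm_num
        _ ≤ N ^ 3 := by gcongr
    nlinarith
  have h2 := tupleLength_le hm k
  have h3 := half_le_log hN
  have e : (Fintype.card (CoverLabel m N k) : ℝ) =
      Real.exp (tupleLength m k * Real.log (4 * N + 1)) := by
    rw [Real.exp_nat_mul, Real.exp_log (by positivity)]
    simp [mul_comm]
  rw [e, Real.exp_le_exp]
  calc tupleLength m k * Real.log (4 * N + 1)
      ≤ (5 * 4 ^ k * Real.log m) * ((4 : ℕ) * Real.log N) :=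
        mul_le_mul h2 h1 (Real.log_nonneg (by linarith)) ((Nat.cast_nonneg _).trans h2)
    _ = _ := by push_cast; ring

section Chaining

variable {m N s : ℕ} {K H : ℝ} {ι : Type*} {v : Fin m → Fin N → ℂ}
  {x : ι → EuclideanSpace ℂ (Fin N)}

/-- Averages of vertices need not be sparse or satisfy the energy bound, so each label is
represented by an index of the family that carries it. Two vectors with one label are compared
through their common average, which doubles 12 to 24. -/
lemma exists_cover [Nonempty ι] (hm : 2 ≤ m) (hs : 2 ≤ s) (hK : 0 < K)
    (hv : ∀ i j, ‖v i j‖ ≤ K) (hx : ∀ j, x j ∈ sparseBall N s) (k : ℕ) :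
    ∃ r : CoverLabel m N k → ι, ∀ j, ∃ τ, ∀ i,
      ‖v i ⬝ᵥ (x j).ofLp - v i ⬝ᵥ (x (r τ)).ofLp‖ ≤ 24 * (√s * K) * (2 ^ k)⁻¹ := by
  have hs0 : 0 < √(s : ℝ) := Real.sqrt_pos.2 (by exact_mod_cast (by omega : 0 < s))
  have hm' : (2 : ℝ) ≤ m := by exact_mod_cast hm
  have hlog : 0 < Real.log (4 * m) := Real.log_pos (by linarith)
  have hn1 : 1 ≤ tupleLength m k := Nat.ceil_pos.2 (by positivity)
  have hn : Real.log (4 * m) ≤ tupleLength m k * ((2 ^ k : ℝ)⁻¹) ^ 2 := by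
    have : (4 : ℝ) ^ k * Real.log (4 * m) ≤ tupleLength m k := Nat.le_ceil _
    rw [inv_pow, ← div_eq_mul_inv, le_div_iff₀ (by positivity), ← pow_mul, mul_comm k, pow_mul]
    norm_num
    linarith
  have hlab := fun j => exists_vertex_tuple hK hs0 (by positivity : 0 < (2 ^ k : ℝ)⁻¹) hv hn1 hn
    (sum_norm_le_of_mem_sparseBall (hx j))
  choose label hlabel using hlab
  refine ⟨Function.invFun label, fun j => ⟨label j, fun i => ?_⟩⟩
  have e : label (Function.invFun label (label j)) = label j := Function.invFun_eq ⟨j, rfl⟩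
  have h1 := hlabel j i
  have h2 := hlabel (Function.invFun label (label j)) i
  rw [e] at h2
  set z := (tupleLength m k : ℂ)⁻¹ * ∑ l, vertexValue √s (v i) (label j l)
  calc _ = ‖(v i ⬝ᵥ (x j).ofLp - z) -
          (v i ⬝ᵥ (x (Function.invFun label (label j))).ofLp - z)‖ := by congr 1; ring
    _ ≤ _ := norm_sub_le _ _
    _ ≤ 12 * (2 ^ k : ℝ)⁻¹ * (√s * K) + 12 * (2 ^ k : ℝ)⁻¹ * (√s * K) := add_le_add h1 h2
    _ = _ := by ring

/-- Factor the difference of squares: one factor is bounded uniformly by `u`, the other in ℓ₂ by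
`H`. This turns uniform covers into variance bounds for the increments. -/
lemma sum_sq_sub_sq_le {κ : Type*} [Fintype κ] {a b : κ → ℂ} {u H : ℝ}
    (ha : ∑ i, ‖a i‖ ^ 2 ≤ H ^ 2) (hb : ∑ i, ‖b i‖ ^ 2 ≤ H ^ 2) (hab : ∀ i, ‖a i - b i‖ ≤ u) :
    ∑ i, (‖a i‖ ^ 2 - ‖b i‖ ^ 2) ^ 2 ≤ (2 * H * u) ^ 2 := by
  calc ∑ i, (‖a i‖ ^ 2 - ‖b i‖ ^ 2) ^ 2
      ≤ ∑ i, u ^ 2 * (2 * (‖a i‖ ^ 2 + ‖b i‖ ^ 2)) := by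
        refine Finset.sum_le_sum fun i _ => ?_
        have h1 : |‖a i‖ - ‖b i‖| ≤ u := (abs_norm_sub_norm_le _ _).trans (hab i)
        have h2 : (‖a i‖ - ‖b i‖) ^ 2 ≤ u ^ 2 := by
          rw [← sq_abs]; exact pow_le_pow_left₀ (abs_nonneg _) h1 2
        have h3 : (‖a i‖ + ‖b i‖) ^ 2 ≤ 2 * (‖a i‖ ^ 2 + ‖b i‖ ^ 2) := by
          nlinarith [sq_nonneg (‖a i‖ - ‖b i‖)]
        calc (‖a i‖ ^ 2 - ‖b i‖ ^ 2) ^ 2 = (‖a i‖ - ‖b i‖) ^ 2 * (‖a i‖ + ‖b i‖) ^ 2 := by ring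
          _ ≤ _ := by gcongr
    _ = u ^ 2 * (2 * (∑ i, ‖a i‖ ^ 2 + ∑ i, ‖b i‖ ^ 2)) := by
        rw [← Finset.mul_sum, ← Finset.mul_sum, Finset.sum_add_distrib]
    _ ≤ u ^ 2 * (2 * (H ^ 2 + H ^ 2)) := by gcongr
    _ = _ := by ring

lemma sqrt_add_mul_le {p c d l : ℝ} (hp : 0 ≤ p) (hd : 0 ≤ d) (hl : 0 ≤ l)
    (hc : c ≤ d ^ 2) : √(p + c * l) ≤ √p + d * √l := by
  rw [Real.sqrt_le_left (by positivity)]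
  have h1 := Real.sq_sqrt hp
  have h2 := Real.sq_sqrt hl
  have h3 : 0 ≤ √p * (d * √l) := by positivity
  nlinarith [mul_le_mul_of_nonneg_right hc hl]

/-- The link from scale `k` to `k + 1` has deviation of order `2⁻ᵏ` and log-cardinality of order
`4ᵏ`. Its `√p` parts sum geometrically, `1 + ∑_{j<k} 2⁻ʲ = 3 - 2·2⁻ᵏ`, while its entropy part is the
same at every scale, whence `k + 1`. -/
lemma radMomentLE_cover (hm : 2 ≤ m) (hN : 2 ≤ N) (hs : 2 ≤ s) (hK : 0 < K)
    (hH : 0 < H) (hv : ∀ i j, ‖v i j‖ ≤ K) (hx : ∀ j, x j ∈ sparseBall N s)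
    (hxH : ∀ j, ∑ i, ‖v i ⬝ᵥ (x j).ofLp‖ ^ 2 ≤ H ^ 2) {r : ∀ k, CoverLabel m N k → ι}
    (hr : ∀ k j, ∃ τ, ∀ i,
      ‖v i ⬝ᵥ (x j).ofLp - v i ⬝ᵥ (x (r k τ)).ofLp‖ ≤ 24 * (√s * K) * (2 ^ k)⁻¹)
    {p : ℕ} (hp : 1 ≤ p) (k : ℕ) :
    RadMomentLE p (fun τ i => ‖v i ⬝ᵥ (x (r k τ)).ofLp‖ ^ 2)
      (24 * (48 * H * (√s * K)) * ((3 - 2 * (2 ^ k)⁻¹) * √p +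
        10 * (k + 1) * √(Real.log m * Real.log N))) := by
  have hs0 : 0 < √(s : ℝ) := Real.sqrt_pos.2 (by exact_mod_cast (by omega : 0 < s))
  have hlm := half_le_log hm
  have hlN := half_le_log hN
  set Λ := Real.log m * Real.log N with hΛ
  have hΛ0 : 0 < Λ := by positivity
  have hsΛ : 0 < √Λ := Real.sqrt_pos.2 hΛ0
  have hsp : 0 < √(p : ℝ) := Real.sqrt_pos.2 (by exact_mod_cast hp)
  have hne : ∀ k, Nonempty (CoverLabel m N k) := fun k => ⟨fun _ => none⟩
  induction k with
  | zero =>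
    refine RadMomentLE.mono (radMomentLE_of_card hp _ (σ := H * (√s * K)) (l := 20 * Λ)
      (by positivity) (by positivity) (fun τ => ?_) ?_) (by positivity) ?_
    · calc ∑ i, (‖v i ⬝ᵥ (x (r 0 τ)).ofLp‖ ^ 2) ^ 2
          ≤ ∑ i, (√s * K) ^ 2 * ‖v i ⬝ᵥ (x (r 0 τ)).ofLp‖ ^ 2 := by
            refine Finset.sum_le_sum fun i _ => ?_
            rw [sq (‖v i ⬝ᵥ (x (r 0 τ)).ofLp‖ ^ 2)]
            gcongr
            refine (norm_dotProduct_le (hv i) _).trans ?_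
            rw [mul_comm]
            gcongr
            exact sum_norm_le_of_mem_sparseBall (hx _)
        _ ≤ (√s * K) ^ 2 * H ^ 2 := by
            rw [← Finset.mul_sum]
            gcongr
            exact hxH _
        _ = _ := by ring
    · simpa using card_coverLabel_le hm hN 0
    · have h1 := sqrt_add_mul_le (p := p) (c := 20) (d := 5) (Nat.cast_nonneg p) (by norm_num)
        hΛ0.le (by norm_num)
      have h2 : H * (√s * K) ≤ 48 * H * (√s * K) := by
        have : 0 < H * (√s * K) := by positivity
        linarith
      calc 24 * (H * (√s * K)) * √(p + 20 * Λ)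
          ≤ 24 * (48 * H * (√s * K)) * (√p + 5 * √Λ) := by gcongr
        _ ≤ _ := by
          gcongr
          norm_num
          linarith
  | succ k ih =>
    have hk0 : (0 : ℝ) < (2 ^ k)⁻¹ := by positivity
    have hk1 : ((2 : ℝ) ^ k)⁻¹ ≤ 1 := inv_le_one_of_one_le₀ (one_le_pow₀ (by norm_num))
    have hW : 0 < 24 * (48 * H * (√s * K)) * ((3 - 2 * (2 ^ k)⁻¹) * √p +
        10 * (k + 1) * √Λ) := by
      have : 0 ≤ (3 - 2 * ((2 : ℝ) ^ k)⁻¹) * √p := mul_nonneg (by linarith) hsp.le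
      positivity
    refine RadMomentLE.mono (RadMomentLE.chain hp hW ih
      (σ := 2 * H * (24 * (√s * K) * (2 ^ k)⁻¹)) (l := 20 * 4 ^ (k + 1) * Λ)
      (by positivity) (by positivity) (fun τ => ?_) (card_coverLabel_le hm hN (k + 1)))
      (by positivity) ?_
    -- The covers need not be nested: a representative at scale `k + 1` is itself a member of the
    -- family, so the cover at scale `k` applies to it.
    · obtain ⟨τ', hτ'⟩ := hr k (r (k + 1) τ)
      exact ⟨τ', sum_sq_sub_sq_le (hxH _) (hxH _) hτ'⟩
    · have h1 := sqrt_add_mul_le (p := p) (c := 20 * 4 ^ (k + 1)) (d := 10 * 2 ^ k)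
        (Nat.cast_nonneg p) (by positivity) hΛ0.le (by
          rw [mul_pow, ← pow_mul, mul_comm k, pow_mul, pow_succ]
          norm_num
          have : (0 : ℝ) < 4 ^ k := by positivity
          linarith)
      calc _ ≤ 24 * (48 * H * (√s * K)) * ((3 - 2 * (2 ^ k)⁻¹) * √p + 10 * (k + 1) * √Λ) +
            24 * (2 * H * (24 * (√s * K) * (2 ^ k)⁻¹)) * (√p + 10 * 2 ^ k * √Λ) := by gcongr
        _ = _ := by
          push_cast
          rw [pow_succ]
          field_simp
          ring

/-- Moments of the Rademacher process indexed by finitely many sparse vectors. -/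
lemma radMomentLE_sparse [Fintype ι] [Nonempty ι] (hm : 2 ≤ m) (hN : 2 ≤ N) (hs : 2 ≤ s)
    (hK : 0 < K) (hH : 0 < H) (hv : ∀ i j, ‖v i j‖ ≤ K) (hx : ∀ j, x j ∈ sparseBall N s)
    (hxH : ∀ j, ∑ i, ‖v i ⬝ᵥ (x j).ofLp‖ ^ 2 ≤ H ^ 2)
    (hcard : (Fintype.card ι : ℝ) ≤ Real.exp (100 * s * (Real.log m * Real.log N)))
    {p : ℕ} (hp : 1 ≤ p) :
    RadMomentLE p (fun j i => ‖v i ⬝ᵥ (x j).ofLp‖ ^ 2)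
      (81000 * (H * (√s * K)) * (√p + Real.log s * √(Real.log m * Real.log N))) := by
  have hs0 : 0 < √(s : ℝ) := Real.sqrt_pos.2 (by exact_mod_cast (by omega : 0 < s))
  have hlm := half_le_log hm
  have hlN := half_le_log hN
  have hls := half_le_log hs
  choose r hr using exists_cover (K := K) (v := v) (x := x) hm hs hK hv hx
  -- Stopping scale: `4^L ≥ e^L ≥ s`, so the factor `2⁻ᴸ` in the last link absorbs the `√s` coming
  -- from the log-cardinality of the full family.
  set L := ⌈Real.log s⌉₊ with hL
  have hW := radMomentLE_cover hm hN hs hK hH hv hx hxH hr hp L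
  set Λ := Real.log m * Real.log N with hΛ
  have hΛ0 : 0 < Λ := by positivity
  have hsΛ : 0 < √Λ := Real.sqrt_pos.2 hΛ0
  have hsp : 0 < √(p : ℝ) := Real.sqrt_pos.2 (by exact_mod_cast hp)
  have hk0 : (0 : ℝ) < (2 ^ L)⁻¹ := by positivity
  have hk1 : ((2 : ℝ) ^ L)⁻¹ ≤ 1 := inv_le_one_of_one_le₀ (one_le_pow₀ (by norm_num))
  have hW0 : 0 < 24 * (48 * H * (√s * K)) * ((3 - 2 * (2 ^ L)⁻¹) * √p +
      10 * (L + 1) * √Λ) := by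
    have : 0 ≤ (3 - 2 * ((2 : ℝ) ^ L)⁻¹) * √p := mul_nonneg (by linarith) hsp.le
    positivity
  have hsL : (s : ℝ) ≤ 4 ^ L := by
    have hs' : (0 : ℝ) < s := by exact_mod_cast (by omega : 0 < s)
    calc (s : ℝ) = Real.exp (Real.log s) := (Real.exp_log hs').symm
      _ ≤ Real.exp ((L : ℝ) * 1) := Real.exp_le_exp.2 (by rw [mul_one]; exact Nat.le_ceil _)
      _ = Real.exp 1 ^ L := Real.exp_nat_mul _ _
      _ ≤ 4 ^ L := pow_le_pow_left₀ (Real.exp_pos _).le (by linarith [Real.exp_one_lt_d9]) _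
  refine RadMomentLE.mono (RadMomentLE.chain hp hW0 hW
    (σ := 2 * H * (24 * (√s * K) * (2 ^ L)⁻¹)) (l := 100 * s * Λ)
    (by positivity) (by positivity) (fun j => ?_) hcard) (by positivity) ?_
  · obtain ⟨τ', hτ'⟩ := hr L j
    exact ⟨τ', sum_sq_sub_sq_le (hxH _) (hxH _) hτ'⟩
  · have h1 := sqrt_add_mul_le (p := p) (c := 100 * s) (d := 10 * 2 ^ L)
      (Nat.cast_nonneg p) (by positivity) hΛ0.le (by
        rw [mul_pow, ← pow_mul, mul_comm L, pow_mul]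
        norm_num
        linarith)
    have hL1 : (L : ℝ) ≤ Real.log s + 1 := (Nat.ceil_lt_add_one (by linarith)).le
    have h2 : (2 ^ L : ℝ)⁻¹ * (√p + 10 * 2 ^ L * √Λ) ≤ √p + 10 * √Λ := by
      rw [mul_add]
      have e : (2 ^ L : ℝ)⁻¹ * (10 * 2 ^ L * √Λ) = 10 * √Λ := by field_simp
      rw [e]
      nlinarith
    have h3 : (L : ℝ) * √Λ ≤ (Real.log s + 1) * √Λ := by gcongr
    have h4 : √Λ ≤ 2 * (Real.log s * √Λ) := by nlinarith
    calc _ ≤ 24 * (48 * H * (√s * K)) * ((3 - 2 * (2 ^ L)⁻¹) * √p + 10 * (L + 1) * √Λ) +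
          24 * (2 * H * (24 * (√s * K) * (2 ^ L)⁻¹)) * (√p + 10 * 2 ^ L * √Λ) := by gcongr
      _ = 24 * (48 * H * (√s * K)) * (((3 - 2 * (2 ^ L)⁻¹) * √p + 10 * (L + 1) * √Λ) +
            (2 ^ L)⁻¹ * (√p + 10 * 2 ^ L * √Λ)) := by ring
      _ ≤ 24 * (48 * H * (√s * K)) * (70 * (√p + Real.log s * √Λ)) := by
          refine mul_le_mul_of_nonneg_left ?_ (by positivity)
          nlinarith [mul_pos hk0 hsp]
      _ ≤ _ := by
          have : 0 ≤ H * (√s * K) * (√p + Real.log s * √Λ) := by positivity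
          nlinarith

end Chaining

/-! ### Symmetrization -/

lemma integrable_of_measurable_of_mem_Icc {Ω : Type*} [MeasurableSpace Ω] {P : Measure Ω}
    [IsFiniteMeasure P] {F : Ω → ℝ} (hF : Measurable F) {a b : ℝ} (h : ∀ ω, F ω ∈ Set.Icc a b) :
    Integrable F P :=
  Integrable.of_mem_Icc a b hF.aemeasurable (Filter.Eventually.of_forall h)

lemma integrable_pow_of_mem_Icc {Ω : Type*} [MeasurableSpace Ω] {P : Measure Ω}
    [IsFiniteMeasure P] {F : Ω → ℝ} (hF : Measurable F) {b : ℝ} (h : ∀ ω, F ω ∈ Set.Icc 0 b)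
    (p : ℕ) : Integrable (fun ω => F ω ^ p) P :=
  integrable_of_measurable_of_mem_Icc (hF.pow_const p) (a := 0) (b := b ^ p)
    fun ω => ⟨pow_nonneg (h ω).1 p, pow_le_pow_left₀ (h ω).1 (h ω).2 p⟩

lemma pow_integral_le {Ω : Type*} [MeasurableSpace Ω] {P : Measure Ω}
    [IsProbabilityMeasure P] {F : Ω → ℝ} (hF : Measurable F) {b : ℝ}
    (h : ∀ ω, F ω ∈ Set.Icc 0 b) (p : ℕ) : (∫ ω, F ω ∂P) ^ p ≤ ∫ ω, F ω ^ p ∂P :=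
  (convexOn_pow p).map_integral_le (continuous_pow p).continuousOn isClosed_Ici
    (Filter.Eventually.of_forall fun ω => (h ω).1) (integrable_of_measurable_of_mem_Icc hF h)
    (integrable_pow_of_mem_Icc hF h p)

section Symmetrization

variable {E : Type*} [MeasurableSpace E] {m : ℕ}

/-- Exchange the `i`-th coordinates of two vectors whenever `ε i` is false. -/
def coordSwap {E : Type*} (ε : Fin m → Bool) (q : (Fin m → E) × (Fin m → E)) : (Fin m → E) × (Fin m → E) :=
  (fun i => if ε i then q.1 i else q.2 i, fun i => if ε i then q.2 i else q.1 i)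

/-- Only the two copies of the same coordinate are exchanged, so the factors `μ i` may differ from
one another. -/
lemma measurePreserving_coordSwap (ε : Fin m → Bool) (μ : Fin m → Measure E)
    [∀ i, IsProbabilityMeasure (μ i)] :
    MeasurePreserving (coordSwap ε) ((Measure.pi μ).prod (Measure.pi μ))
      ((Measure.pi μ).prod (Measure.pi μ)) := by
  have h1 := measurePreserving_arrowProdEquivProdArrow E E (Fin m) μ μ
  have h2 : MeasurePreserving (fun (e : Fin m → E × E) i => (if ε i then id else Prod.swap) (e i))
      (Measure.pi fun i => (μ i).prod (μ i)) (Measure.pi fun i => (μ i).prod (μ i)) := by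
    refine measurePreserving_pi _ _ (f := fun i => if ε i then id else Prod.swap) fun i => ?_
    split_ifs
    · exact MeasurePreserving.id _
    · exact Measure.measurePreserving_swap
  convert h1.comp (h2.comp (h1.symm _)) using 1
  funext q
  refine Prod.ext (funext fun i => ?_) (funext fun i => ?_)
  · cases h : ε i <;>
      simp [coordSwap, h, MeasurableEquiv.arrowProdEquivProdArrow, Equiv.arrowProdEquivProdArrow]
  · cases h : ε i <;>
      simp [coordSwap, h, MeasurableEquiv.arrowProdEquivProdArrow, Equiv.arrowProdEquivProdArrow]

variable {ι : Type*}

/-- The supremum over `j` of the Rademacher sums with coefficients `a j`. -/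
noncomputable def radSup (ε : Fin m → Bool) (a : ι → Fin m → ℝ) : ℝ := ⨆ j, |radSum ε (a j)|

lemma radSup_nonneg (ε : Fin m → Bool) (a : ι → Fin m → ℝ) : 0 ≤ radSup ε a :=
  iSup_abs_radSum_nonneg ε a

lemma radSup_le [Nonempty ι] {ε : Fin m → Bool} {a : ι → Fin m → ℝ} {B : ℝ}
    (ha : ∀ j i, |a j i| ≤ B) : radSup ε a ≤ m * B := by
  refine ciSup_le fun j => (Finset.abs_sum_le_sum_abs _ _).trans ?_
  calc ∑ i, |boolSign (ε i) * a j i| ≤ ∑ _i : Fin m, B := by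
        gcongr with i
        rw [abs_mul, abs_boolSign, one_mul]
        exact ha j i
    _ = m * B := by simp

lemma radSup_sub_le [Finite ι] [Nonempty ι] (ε : Fin m → Bool) (a b : ι → Fin m → ℝ) :
    radSup ε (a - b) ≤ radSup ε a + radSup ε b := by
  refine ciSup_le fun j => ?_
  rw [Pi.sub_apply, radSum_sub]
  exact (abs_sub _ _).trans (add_le_add (abs_radSum_le_iSup ε a j) (abs_radSum_le_iSup ε b j))

lemma measurable_radSup [Finite ι] {Ω : Type*} [MeasurableSpace Ω] (ε : Fin m → Bool)
    {a : Ω → ι → Fin m → ℝ} (ha : ∀ j i, Measurable fun ω => a ω j i) :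
    Measurable fun ω => radSup ε (a ω) := by
  unfold radSup radSum
  refine Measurable.iSup fun j => ?_
  exact (Finset.measurable_sum _ fun i _ => (ha j i).const_mul _).abs

lemma measurable_radAvg {Ω : Type*} [MeasurableSpace Ω] {F : Ω → (Fin m → Bool) → ℝ}
    (hF : ∀ ε, Measurable fun ω => F ω ε) : Measurable fun ω => radAvg (F ω) :=
  Finset.measurable_sum _ fun ε _ => (hF ε).const_mul _

lemma integral_radAvg {Ω : Type*} [MeasurableSpace Ω] {P : Measure Ω}
    {F : Ω → (Fin m → Bool) → ℝ} (hF : ∀ ε, Integrable (fun ω => F ω ε) P) :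
    ∫ ω, radAvg (F ω) ∂P = radAvg fun ε => ∫ ω, F ω ε ∂P := by
  unfold radAvg
  rw [integral_finsetSum _ fun ε _ => (hF ε).const_mul _]
  exact Finset.sum_congr rfl fun ε _ => integral_const_mul _ _

lemma radAvg_const (c : ℝ) : radAvg (fun _ : Fin m → Bool => c) = c := by
  rw [radAvg, ← Finset.sum_mul, sum_radAvg_weights, one_mul]

section Difference

lemma abs_coeff_sub_le {Y : Type*} {A : Y → ι → Fin m → ℝ} {B : ℝ} (hB : ∀ y j i, |A y j i| ≤ B) (y y' : Y) (j : ι) (i : Fin m) :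
    |(A y - A y') j i| ≤ B + B :=
  (abs_sub _ _).trans (add_le_add (hB y j i) (hB y' j i))

variable {Y : Type*} [MeasurableSpace Y] {A : Y → ι → Fin m → ℝ} {B : ℝ}

lemma measurable_coeff_sub (hA : ∀ j i, Measurable fun y => A y j i) (j : ι) (i : Fin m) :
    Measurable fun q : Y × Y => (A q.1 - A q.2) j i :=
  ((hA j i).comp measurable_fst).sub ((hA j i).comp measurable_snd)

variable [Finite ι] [Nonempty ι]

lemma integrable_radSup_pow (Q : Measure Y) [IsProbabilityMeasure Q]
    (hA : ∀ j i, Measurable fun y => A y j i) (hB : ∀ y j i, |A y j i| ≤ B) (ε : Fin m → Bool)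
    (p : ℕ) : Integrable (fun y => radSup ε (A y) ^ p) Q :=
  integrable_pow_of_mem_Icc (measurable_radSup ε hA)
    (fun y => ⟨radSup_nonneg _ _, radSup_le (hB y)⟩) p

lemma integrable_radSup_sub_pow (Q : Measure Y) [IsProbabilityMeasure Q]
    (hA : ∀ j i, Measurable fun y => A y j i) (hB : ∀ y j i, |A y j i| ≤ B) (ε : Fin m → Bool)
    (p : ℕ) : Integrable (fun q : Y × Y => radSup ε (A q.1 - A q.2) ^ p) (Q.prod Q) :=
  integrable_radSup_pow (A := fun q : Y × Y => A q.1 - A q.2) (Q.prod Q)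
    (measurable_coeff_sub hA) (fun q => abs_coeff_sub_le hB q.1 q.2) ε p

/-- The mean is an average over an independent copy; Jensen takes this average out of the supremum
and then out of the power. -/
lemma radSup_sub_mean_pow_le (Q : Measure Y) [IsProbabilityMeasure Q]
    (hA : ∀ j i, Measurable fun y => A y j i) (hB : ∀ y j i, |A y j i| ≤ B) (ε : Fin m → Bool)
    (p : ℕ) (y : Y) :
    radSup ε (A y - fun j i => ∫ y', A y' j i ∂Q) ^ p ≤
      ∫ y', radSup ε (A y - A y') ^ p ∂Q := by
  have hAint : ∀ j i, Integrable (fun y => A y j i) Q := fun j i =>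
    integrable_of_measurable_of_mem_Icc (hA j i) fun y => abs_le.1 (hB y j i)
  have hsec : Measurable fun y' => radSup ε (A y - A y') :=
    measurable_radSup ε fun j i => measurable_const.sub (hA j i)
  have hmem : ∀ y', radSup ε (A y - A y') ∈ Set.Icc 0 (m * (B + B)) := fun y' =>
    ⟨radSup_nonneg _ _, radSup_le (abs_coeff_sub_le hB y y')⟩
  refine le_trans (pow_le_pow_left₀ (radSup_nonneg _ _) (ciSup_le fun j => ?_) p)
    (pow_integral_le hsec hmem p)
  have e1 : radSum ε ((A y - fun j i => ∫ y', A y' j i ∂Q) j) =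
      ∫ y', radSum ε ((A y - A y') j) ∂Q := by
    have hi : ∀ i, Integrable (fun y' => boolSign (ε i) * (A y j i - A y' j i)) Q := fun i =>
      ((integrable_const _).sub (hAint j i)).const_mul _
    simp only [radSum, Pi.sub_apply]
    rw [integral_finsetSum _ fun i _ => hi i]
    refine Finset.sum_congr rfl fun i _ => ?_
    rw [integral_const_mul]
    rw [integral_sub (integrable_const _) (hAint j i)]
    simp
  rw [e1]
  exact abs_integral_le_integral_abs.trans (integral_mono_of_nonneg
    (Filter.Eventually.of_forall fun _ => abs_nonneg _)
    (integrable_of_measurable_of_mem_Icc hsec hmem)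
    (Filter.Eventually.of_forall fun y' => abs_radSum_le_iSup ε (A y - A y') j))

lemma integral_radSup_sub_mean_pow_le (Q : Measure Y) [IsProbabilityMeasure Q]
    (hA : ∀ j i, Measurable fun y => A y j i) (hB : ∀ y j i, |A y j i| ≤ B) (ε : Fin m → Bool)
    (p : ℕ) :
    ∫ y, radSup ε (A y - fun j i => ∫ y', A y' j i ∂Q) ^ p ∂Q ≤
      ∫ q, radSup ε (A q.1 - A q.2) ^ p ∂(Q.prod Q) := by
  rw [integral_prod _ (integrable_radSup_sub_pow Q hA hB ε p)]
  exact integral_mono_of_nonneg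
    (Filter.Eventually.of_forall fun y => pow_nonneg (radSup_nonneg _ _) p)
    (integrable_radSup_sub_pow Q hA hB ε p).integral_prod_left
    (Filter.Eventually.of_forall (radSup_sub_mean_pow_le Q hA hB ε p))

lemma integral_radSup_sub_pow_le (Q : Measure Y) [IsProbabilityMeasure Q]
    (hA : ∀ j i, Measurable fun y => A y j i) (hB : ∀ y j i, |A y j i| ≤ B) (ε : Fin m → Bool)
    {p : ℕ} (hp : 1 ≤ p) :
    ∫ q, radSup ε (A q.1 - A q.2) ^ p ∂(Q.prod Q) ≤ 2 ^ p * ∫ y, radSup ε (A y) ^ p ∂Q := by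
  have hint := integrable_radSup_pow Q hA hB ε p
  have i1 : Integrable (fun q : Y × Y => radSup ε (A q.1) ^ p) (Q.prod Q) := hint.comp_fst Q
  have i2 : Integrable (fun q : Y × Y => radSup ε (A q.2) ^ p) (Q.prod Q) := hint.comp_snd Q
  have e1 : ∫ q, radSup ε (A q.1) ^ p ∂(Q.prod Q) = ∫ y, radSup ε (A y) ^ p ∂Q := by
    rw [integral_fun_fst (fun y => radSup ε (A y) ^ p)]; simp
  have e2 : ∫ q, radSup ε (A q.2) ^ p ∂(Q.prod Q) = ∫ y, radSup ε (A y) ^ p ∂Q := by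
    rw [integral_fun_snd (fun y => radSup ε (A y) ^ p)]; simp
  calc ∫ q, radSup ε (A q.1 - A q.2) ^ p ∂(Q.prod Q)
      ≤ ∫ q, 2 ^ (p - 1) * (radSup ε (A q.1) ^ p + radSup ε (A q.2) ^ p) ∂(Q.prod Q) := by
        refine integral_mono (integrable_radSup_sub_pow Q hA hB ε p)
          ((i1.add i2).const_mul _) fun q => ?_
        exact (pow_le_pow_left₀ (radSup_nonneg _ _) (radSup_sub_le ε _ _) p).trans
          (add_pow_le (radSup_nonneg _ _) (radSup_nonneg _ _) p)
    _ = 2 ^ p * ∫ y, radSup ε (A y) ^ p ∂Q := by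
        rw [integral_const_mul, integral_add i1 i2, e1, e2]
        obtain ⟨k, rfl⟩ := Nat.exists_eq_add_of_le' hp
        rw [Nat.add_sub_cancel, pow_succ]
        ring

end Difference

/-- The coefficients `f j (e i)`. -/
def evalCoeff {E : Type*} (f : ι → E → ℝ) (e : Fin m → E) : ι → Fin m → ℝ := fun j i => f j (e i)

lemma radSup_coordSwap {E : Type*} (ε : Fin m → Bool) (f : ι → E → ℝ)
    (q : (Fin m → E) × (Fin m → E)) :
    radSup (fun _ => true) (evalCoeff f (coordSwap ε q).1 - evalCoeff f (coordSwap ε q).2) =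
      radSup ε (evalCoeff f q.1 - evalCoeff f q.2) := by
  unfold radSup radSum
  congr 1
  funext j
  congr 1
  refine Finset.sum_congr rfl fun i _ => ?_
  cases h : ε i <;> simp [coordSwap, evalCoeff, h, boolSign]

variable {f : ι → E → ℝ} {B : ℝ}

lemma measurable_evalCoeff (hf : ∀ j, Measurable (f j)) (j : ι) (i : Fin m) :
    Measurable fun e : Fin m → E => evalCoeff f e j i :=
  (hf j).comp (measurable_pi_apply i)

variable [Finite ι] [Nonempty ι]

/-- Subtract an independent copy, exchange coordinates to insert signs without changing the
integral, average over the signs, and separate the copies by convexity of the power. The constant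
sign `true` encodes the unsigned sum. -/
lemma integral_radSup_pi_le (μ : Fin m → Measure E) [∀ i, IsProbabilityMeasure (μ i)]
    (hf : ∀ j, Measurable (f j)) (hB : ∀ j e, |f j e| ≤ B) {p : ℕ} (hp : 1 ≤ p) :
    ∫ e, radSup (fun _ => true) (evalCoeff f e -
        fun j i => ∫ e', evalCoeff f e' j i ∂(Measure.pi μ)) ^ p ∂(Measure.pi μ) ≤
      2 ^ p * ∫ e, radAvg (fun ε => radSup ε (evalCoeff f e) ^ p) ∂(Measure.pi μ) := by
  have hA := measurable_evalCoeff (m := m) hf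
  have hB' : ∀ (e : Fin m → E) j i, |evalCoeff f e j i| ≤ B := fun e j i => hB j (e i)
  generalize hQ : Measure.pi μ = Q
  have : IsProbabilityMeasure Q := hQ ▸ inferInstance
  have hswap : ∀ ε, ∫ q, radSup (fun _ => true) (evalCoeff f q.1 - evalCoeff f q.2) ^ p
      ∂(Q.prod Q) = ∫ q, radSup ε (evalCoeff f q.1 - evalCoeff f q.2) ^ p ∂(Q.prod Q) := by
    intro ε
    have hmp := measurePreserving_coordSwap ε μ
    rw [hQ] at hmp
    have h1 : ∫ q, radSup (fun _ => true) (evalCoeff f q.1 - evalCoeff f q.2) ^ p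
        ∂(Measure.map (coordSwap ε) (Q.prod Q)) = ∫ q, radSup (fun _ => true)
          (evalCoeff f (coordSwap ε q).1 - evalCoeff f (coordSwap ε q).2) ^ p ∂(Q.prod Q) :=
      integral_map hmp.measurable.aemeasurable
        ((measurable_radSup _ (measurable_coeff_sub hA)).pow_const p).aestronglyMeasurable
    rw [hmp.map_eq] at h1
    rw [h1]
    exact integral_congr_ae (Filter.Eventually.of_forall fun q =>
      congrArg (· ^ p) (radSup_coordSwap ε f q))
  calc _ ≤ ∫ q, radSup (fun _ => true) (evalCoeff f q.1 - evalCoeff f q.2) ^ p ∂(Q.prod Q) :=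
        integral_radSup_sub_mean_pow_le Q hA hB' _ p
    _ = radAvg fun _ : Fin m → Bool =>
          ∫ q, radSup (fun _ => true) (evalCoeff f q.1 - evalCoeff f q.2) ^ p ∂(Q.prod Q) :=
        (radAvg_const _).symm
    _ ≤ radAvg fun ε => 2 ^ p * ∫ e, radSup ε (evalCoeff f e) ^ p ∂Q :=
        radAvg_mono fun ε => (hswap ε).le.trans (integral_radSup_sub_pow_le Q hA hB' ε hp)
    _ = _ := by
        rw [radAvg_const_mul, integral_radAvg fun ε => integrable_radSup_pow Q hA hB' ε p]

/-- Symmetrization of the moments of a bounded empirical process. -/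
lemma integral_radSup_le {Ω : Type*} [MeasurableSpace Ω] {P : Measure Ω}
    [IsProbabilityMeasure P] {X : Fin m → Ω → E} (hX : ∀ i, Measurable (X i))
    (hind : iIndepFun X P) (hf : ∀ j, Measurable (f j)) (hB : ∀ j e, |f j e| ≤ B)
    {p : ℕ} (hp : 1 ≤ p) :
    ∫ ω, radSup (fun _ => true) ((fun j i => f j (X i ω)) -
        fun j i => ∫ ω', f j (X i ω') ∂P) ^ p ∂P ≤
      2 ^ p * ∫ ω, radAvg (fun ε => radSup ε (fun j i => f j (X i ω)) ^ p) ∂P := by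
  have hprob : ∀ i, IsProbabilityMeasure (P.map (X i)) := fun i =>
    Measure.isProbabilityMeasure_map (hX i).aemeasurable
  have hmap := (iIndepFun_iff_map_fun_eq_pi_map fun i => (hX i).aemeasurable).1 hind
  have hXm : Measurable fun ω i => X i ω := measurable_pi_lambda _ hX
  have hA := measurable_evalCoeff (m := m) hf
  have h := integral_radSup_pi_le (fun i => P.map (X i)) hf hB hp
  have hmean : ∀ j i, ∫ e, evalCoeff f e j i ∂(P.map fun ω i => X i ω) =
      ∫ ω', f j (X i ω') ∂P := fun j i =>
    integral_map hXm.aemeasurable (hA j i).aestronglyMeasurable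
  rw [← hmap] at h
  simp_rw [hmean] at h
  rw [integral_map hXm.aemeasurable, integral_map hXm.aemeasurable] at h
  · exact h
  · exact (measurable_radAvg fun ε =>
      (measurable_radSup ε hA).pow_const p).aestronglyMeasurable
  · exact ((measurable_radSup _ fun j i =>
      (hA j i).sub measurable_const).pow_const p).aestronglyMeasurable

end Symmetrization

/-! ### Moments and tail of the deviation on a finite family -/

section Moments

variable {m N s : ℕ} {K : ℝ}

open Classical in
/-- The vector `v` if its entries are bounded by `K`, and `0` otherwise. -/
noncomputable def boundedPart (K : ℝ) (v : EuclideanSpace ℂ (Fin N)) : Fin N → ℂ :=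
  if ∀ j, ‖v j‖ ≤ K then v.ofLp else 0

lemma boundedPart_of_le {v : EuclideanSpace ℂ (Fin N)} (hv : ∀ j, ‖v j‖ ≤ K) :
    boundedPart K v = v.ofLp := if_pos hv

lemma norm_boundedPart_le (hK : 0 ≤ K) (v : EuclideanSpace ℂ (Fin N)) (j : Fin N) :
    ‖boundedPart K v j‖ ≤ K := by
  unfold boundedPart
  split_ifs with h
  · exact h j
  · simpa using hK

lemma measurable_boundedPart :
    Measurable (boundedPart K : EuclideanSpace ℂ (Fin N) → Fin N → ℂ) := by
  refine Measurable.ite ?_ (by fun_prop) measurable_const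
  have : {v : EuclideanSpace ℂ (Fin N) | ∀ j, ‖v j‖ ≤ K} = ⋂ j, {v | ‖v j‖ ≤ K} := by
    ext; simp
  rw [this]
  exact MeasurableSet.iInter fun j => measurableSet_le (by fun_prop) measurable_const

/-- The energy of the truncated sample `v` in the direction `x`. -/
noncomputable def energy (K : ℝ) (x v : EuclideanSpace ℂ (Fin N)) : ℝ :=
  ‖boundedPart K v ⬝ᵥ x.ofLp‖ ^ 2

lemma measurable_energy (x : EuclideanSpace ℂ (Fin N)) : Measurable (energy K x) := by
  have : Measurable fun v : EuclideanSpace ℂ (Fin N) => boundedPart K v ⬝ᵥ x.ofLp := by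
    unfold dotProduct
    exact Finset.measurable_sum _ fun j _ =>
      ((measurable_pi_apply j).comp measurable_boundedPart).mul_const _
  exact this.norm.pow_const 2

lemma energy_nonneg (x v : EuclideanSpace ℂ (Fin N)) : 0 ≤ energy K x v := by
  unfold energy; positivity

lemma energy_le (hK : 0 ≤ K) {x : EuclideanSpace ℂ (Fin N)} (hx : x ∈ sparseBall N s)
    (v : EuclideanSpace ℂ (Fin N)) : energy K x v ≤ (K * √s) ^ 2 := by
  refine pow_le_pow_left₀ (norm_nonneg _)
    ((norm_dotProduct_le (norm_boundedPart_le hK v) _).trans ?_) 2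
  exact mul_le_mul_of_nonneg_left (sum_norm_le_of_mem_sparseBall hx) hK

variable {ι : Type*} {y : ι → EuclideanSpace ℂ (Fin N)}

/-- The largest deviation of `∑ ‖⟨X i, y j⟩‖ ^ 2` from `m * ‖y j‖ ^ 2`. -/
noncomputable def deviation (K : ℝ) (y : ι → EuclideanSpace ℂ (Fin N))
    (v : Fin m → EuclideanSpace ℂ (Fin N)) : ℝ :=
  ⨆ j, |∑ i, energy K (y j) (v i) - m * ‖y j‖ ^ 2|

lemma deviation_nonneg (v : Fin m → EuclideanSpace ℂ (Fin N)) : 0 ≤ deviation K y v :=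
  Real.iSup_nonneg fun _ => abs_nonneg _

lemma abs_sub_le_deviation [Finite ι] (v : Fin m → EuclideanSpace ℂ (Fin N)) (j : ι) :
    |∑ i, energy K (y j) (v i) - m * ‖y j‖ ^ 2| ≤ deviation K y v :=
  le_ciSup (f := fun j => |∑ i, energy K (y j) (v i) - m * ‖y j‖ ^ 2|)
    (Set.finite_range _).bddAbove j

lemma deviation_le [Nonempty ι] (hK : 0 ≤ K) (hy : ∀ j, y j ∈ sparseBall N s)
    (v : Fin m → EuclideanSpace ℂ (Fin N)) : deviation K y v ≤ m * ((K * √s) ^ 2 + 1) := by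
  refine ciSup_le fun j => abs_le.2 ?_
  have h1 : ∑ i, energy K (y j) (v i) ≤ m * (K * √s) ^ 2 := by
    calc ∑ i, energy K (y j) (v i) ≤ ∑ _i : Fin m, (K * √s) ^ 2 :=
          Finset.sum_le_sum fun i _ => energy_le hK (hy j) _
      _ = _ := by simp
  have h2 : 0 ≤ ∑ i, energy K (y j) (v i) := Finset.sum_nonneg fun i _ => energy_nonneg _ _
  have h3 : ‖y j‖ ^ 2 ≤ 1 := pow_le_one₀ (norm_nonneg _) (hy j).2
  have h4 : (m : ℝ) * ‖y j‖ ^ 2 ≤ m * 1 := by gcongr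
  have h5 : 0 ≤ (m : ℝ) * ‖y j‖ ^ 2 := by positivity
  have h6 : 0 ≤ (m : ℝ) * (K * √s) ^ 2 := by positivity
  have h7 : (0 : ℝ) ≤ m := Nat.cast_nonneg m
  constructor <;> linarith

lemma measurable_deviation [Finite ι] :
    Measurable (deviation K y : (Fin m → EuclideanSpace ℂ (Fin N)) → ℝ) := by
  unfold deviation
  refine Measurable.iSup fun j => ?_
  exact ((Finset.measurable_sum _ fun i _ =>
    (measurable_energy _).comp (measurable_pi_apply i)).sub measurable_const).abs

/-- Chaining with `H² = m + deviation`, a legitimate energy bound since `‖y j‖ ≤ 1`. This puts the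
deviation itself on the right-hand side. -/
lemma radAvg_energy_le [Fintype ι] [Nonempty ι] (hm : 2 ≤ m) (hN : 2 ≤ N) (hs : 2 ≤ s)
    (hK : 0 < K) (hy : ∀ j, y j ∈ sparseBall N s)
    (hcard : (Fintype.card ι : ℝ) ≤ Real.exp (100 * s * (Real.log m * Real.log N)))
    {r : ℕ} (hr : 1 ≤ r) (v : Fin m → EuclideanSpace ℂ (Fin N)) :
    radAvg (fun ε => radSup ε (fun j i => energy K (y j) (v i)) ^ (2 * r)) ≤
      (81000 ^ 2 * (s * K ^ 2) *
        (√(2 * r : ℕ) + Real.log s * √(Real.log m * Real.log N)) ^ 2) ^ r *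
        (m + deviation K y v) ^ r := by
  have hm' : (0 : ℝ) < m := by exact_mod_cast (by omega : 0 < m)
  have hd := deviation_nonneg (K := K) (y := y) v
  have hH : 0 < √(m + deviation K y v) := Real.sqrt_pos.2 (by linarith)
  have h := radMomentLE_sparse hm hN hs hK hH (v := fun i => boundedPart K (v i)) (x := y)
    (fun i j => norm_boundedPart_le hK.le _ j) hy (fun j => by
      rw [Real.sq_sqrt (by linarith)]
      have h1 := (abs_le.1 (abs_sub_le_deviation (K := K) (y := y) v j)).2
      have h2 : (m : ℝ) * ‖y j‖ ^ 2 ≤ m * 1 := by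
        gcongr
        exact pow_le_one₀ (norm_nonneg _) (hy j).2
      simp only [energy] at h1
      linarith) hcard (p := 2 * r) (by omega)
  refine h.trans (le_of_eq ?_)
  rw [pow_mul, ← mul_pow]
  congr 1
  rw [mul_pow, mul_pow, mul_pow, mul_pow, Real.sq_sqrt (by linarith),
    Real.sq_sqrt (Nat.cast_nonneg s)]
  ring

lemma one_add_pow_le {z : ℝ} (hz : 0 ≤ z) (r : ℕ) : (1 + z) ^ r ≤ 2 ^ r * (2 + z ^ (2 * r)) := by
  have h1 : (1 + z) ^ r ≤ 2 ^ r * (1 + z ^ r) := by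
    refine (add_pow_le zero_le_one hz r).trans ?_
    rw [one_pow]
    gcongr
    · norm_num
    · omega
  have h2 : 1 + z ^ r ≤ 2 + z ^ (2 * r) := by
    rw [mul_comm 2 r, pow_mul]
    nlinarith [sq_nonneg (z ^ r - 1), pow_nonneg hz r]
  exact h1.trans (by gcongr)

variable {Ω : Type*} [MeasurableSpace Ω] {P : Measure Ω} [IsProbabilityMeasure P]

/-- The moments of the deviation of the empirical process are small if `m` is large. -/
lemma integral_deviation_pow_le [Fintype ι] [Nonempty ι] (hm : 2 ≤ m) (hN : 2 ≤ N) (hs : 2 ≤ s)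
    (hK : 0 < K) (hy : ∀ j, y j ∈ sparseBall N s)
    (hcard : (Fintype.card ι : ℝ) ≤ Real.exp (100 * s * (Real.log m * Real.log N)))
    {X : Fin m → Ω → EuclideanSpace ℂ (Fin N)} (hX : ∀ i, Measurable (X i))
    (hind : iIndepFun X P)
    (hmean : ∀ j, ∑ i, ∫ ω, energy K (y j) (X i ω) ∂P = m * ‖y j‖ ^ 2) {r : ℕ} (hr : 1 ≤ r)
    {β : ℝ} (hβ : 162000 ^ 2 * (s * K ^ 2) *
      (√(2 * r : ℕ) + Real.log s * √(Real.log m * Real.log N)) ^ 2 ≤ β * m) (hβ1 : β ≤ 1 / 4) :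
    ∫ ω, (deviation K y (fun i => X i ω) / m) ^ (2 * r) ∂P ≤ 4 * (2 * β) ^ r := by
  have hm' : (0 : ℝ) < m := by exact_mod_cast (by omega : 0 < m)
  set D : Ω → ℝ := fun ω => deviation K y (fun i => X i ω) with hD
  set G := √(2 * r : ℕ) + Real.log s * √(Real.log m * Real.log N) with hG
  have hβ0 : 0 ≤ β := by
    have : 0 ≤ 162000 ^ 2 * (s * K ^ 2) * G ^ 2 := by positivity
    exact nonneg_of_mul_nonneg_left (this.trans hβ) hm'
  have hDm : Measurable D := measurable_deviation.comp (measurable_pi_lambda _ hX)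
  have hD0 : ∀ ω, 0 ≤ D ω := fun ω => deviation_nonneg _
  have hDb : ∀ ω, D ω ≤ m * ((K * √s) ^ 2 + 1) := fun ω => deviation_le hK.le hy _
  have hsup : ∀ ω, radSup (fun _ => true) ((fun j i => energy K (y j) (X i ω)) -
      fun j i => ∫ ω', energy K (y j) (X i ω') ∂P) = D ω := by
    intro ω
    unfold radSup radSum
    simp only [hD, deviation]
    congr 1
    funext j
    congr 1
    simp [boolSign, Finset.sum_sub_distrib, hmean j]
  have hsym := integral_radSup_le hX hind (f := fun j => energy K (y j))
    (fun j => measurable_energy (y j)) (B := (K * √s) ^ 2)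
    (fun j e => by rw [abs_of_nonneg (energy_nonneg _ _)]; exact energy_le hK.le (hy j) e)
    (p := 2 * r) (by omega)
  simp_rw [hsup] at hsym
  have hmD : Measurable fun ω => m + D ω := measurable_const.add hDm
  have hint1 : Integrable (fun ω => (m + D ω) ^ r) P :=
    integrable_pow_of_mem_Icc hmD
      (b := m + m * ((K * √s) ^ 2 + 1)) (fun ω => ⟨by linarith [hD0 ω], by linarith [hDb ω]⟩) r
  have hint2 : Integrable (fun ω => (D ω / m) ^ (2 * r)) P :=
    integrable_pow_of_mem_Icc (hDm.div_const _) (b := m * ((K * √s) ^ 2 + 1) / m)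
      (fun ω => ⟨div_nonneg (hD0 ω) hm'.le, div_le_div_of_nonneg_right (hDb ω) hm'.le⟩) _
  have hbound : ∫ ω, D ω ^ (2 * r) ∂P ≤ (β * m) ^ r * ∫ ω, (m + D ω) ^ r ∂P := by
    refine hsym.trans ?_
    calc _ ≤ 2 ^ (2 * r) * ∫ ω, (81000 ^ 2 * (s * K ^ 2) * G ^ 2) ^ r * (m + D ω) ^ r ∂P := by
          refine mul_le_mul_of_nonneg_left (integral_mono_of_nonneg
            (Filter.Eventually.of_forall fun ω => radAvg_nonneg fun ε =>
              pow_nonneg (radSup_nonneg _ _) _)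
            (hint1.const_mul _) (Filter.Eventually.of_forall fun ω =>
              radAvg_energy_le hm hN hs hK hy hcard hr _)) (by positivity)
      _ = (162000 ^ 2 * (s * K ^ 2) * G ^ 2) ^ r * ∫ ω, (m + D ω) ^ r ∂P := by
          rw [integral_const_mul, ← mul_assoc, pow_mul, ← mul_pow]
          congr 2
          ring
      _ ≤ _ := by
          refine mul_le_mul_of_nonneg_right (pow_le_pow_left₀ (by positivity) hβ r)
            (integral_nonneg fun ω => pow_nonneg (by linarith [hD0 ω]) r)
  set q := ∫ ω, (D ω / m) ^ (2 * r) ∂P with hq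
  have e1 : ∫ ω, D ω ^ (2 * r) ∂P = m ^ (2 * r) * q := by
    rw [hq, ← integral_const_mul]
    refine integral_congr_ae (Filter.Eventually.of_forall fun ω => ?_)
    simp only [div_pow]
    field_simp
  have e2 : ∫ ω, (m + D ω) ^ r ∂P ≤ m ^ r * (2 ^ r * (2 + q)) := by
    calc ∫ ω, (m + D ω) ^ r ∂P
        ≤ ∫ ω, m ^ r * (2 ^ r * (2 + (D ω / m) ^ (2 * r))) ∂P := by
          refine integral_mono hint1
            ((((integrable_const 2).add hint2).const_mul _).const_mul _) fun ω => ?_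
          have : (m : ℝ) + D ω = m * (1 + D ω / m) := by field_simp
          simp only [this, mul_pow]
          exact mul_le_mul_of_nonneg_left
            (one_add_pow_le (div_nonneg (hD0 ω) hm'.le) r) (by positivity)
      _ = _ := by
          rw [integral_const_mul, integral_const_mul, integral_add (integrable_const 2) hint2]
          simp [hq]
  -- The self-bounding inequality, normalized by `m^(2r)`. Since `(2β)^r ≤ 1/2`, the term in `q` on
  -- the right is absorbed.
  have hq1 : q ≤ (2 * β) ^ r * (2 + q) := by
    have h1 : (m : ℝ) ^ (2 * r) * q ≤ m ^ (2 * r) * ((2 * β) ^ r * (2 + q)) := by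
      rw [← e1]
      refine hbound.trans ((mul_le_mul_of_nonneg_left e2 (by positivity)).trans (le_of_eq ?_))
      rw [mul_pow, mul_pow, two_mul, pow_add]
      ring
    exact le_of_mul_le_mul_left h1 (by positivity)
  have hq0 : 0 ≤ q := integral_nonneg fun ω => by positivity [hD0 ω]
  have h2β : (2 * β) ^ r ≤ 1 / 2 := by
    calc (2 * β) ^ r ≤ (2 * β) ^ 1 :=
          pow_le_pow_of_le_one (by linarith) (by linarith) hr
      _ ≤ 1 / 2 := by linarith
  nlinarith [pow_nonneg (by linarith : 0 ≤ 2 * β) r]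

/-- The deviation of the empirical process is small with high probability. -/
lemma measure_deviation_ge_le [Fintype ι] [Nonempty ι] (hm : 2 ≤ m) (hN : 2 ≤ N) (hs : 2 ≤ s)
    (hK : 0 < K) (hy : ∀ j, y j ∈ sparseBall N s)
    (hcard : (Fintype.card ι : ℝ) ≤ Real.exp (100 * s * (Real.log m * Real.log N)))
    {X : Fin m → Ω → EuclideanSpace ℂ (Fin N)} (hX : ∀ i, Measurable (X i))
    (hind : iIndepFun X P)
    (hmean : ∀ j, ∑ i, ∫ ω, energy K (y j) (X i ω) ∂P = m * ‖y j‖ ^ 2) {delta eta : ℝ}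
    (hd : 0 < delta) (hd1 : delta < 1) (he : 0 < eta) (he1 : eta < 1)
    (hsamp : SampleCondition (10 ^ 15) (10 ^ 15) m N s K delta eta) :
    P {ω | delta / 2 ≤ deviation K y (fun i => X i ω) / m} ≤ ENNReal.ofReal eta := by
  have hm' : (0 : ℝ) < m := by exact_mod_cast (by omega : 0 < m)
  have hs' : (0 : ℝ) < s := by exact_mod_cast (by omega : 0 < s)
  have hlm := half_le_log hm
  have hlN := half_le_log hN
  have hls := half_le_log hs
  set l := Real.log eta⁻¹ with hl
  have hl0 : 0 ≤ l := Real.log_nonneg ((one_le_inv₀ he).2 he1.le)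
  set r := ⌈l⌉₊ + 1 with hr
  have hr1 : 1 ≤ r := by omega
  have hrl : l ≤ r := (Nat.le_ceil l).trans (by rw [hr]; push_cast; linarith)
  have hrl2 : (r : ℝ) ≤ l + 2 := by
    have := Nat.ceil_lt_add_one hl0
    rw [hr]; push_cast; linarith
  set Λ := Real.log m * Real.log N with hΛ
  have hΛ4 : 1 / 4 ≤ Λ := by nlinarith
  set M := Real.log s ^ 2 * Λ with hM
  have hM16 : 1 / 16 ≤ M := by nlinarith [pow_le_pow_left₀ (by norm_num) hls 2]
  -- The square is at most `4r + 2M` with `r ≤ l + 2`; the remaining 8 is absorbed in `128 M`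
  -- because `M ≥ 1/16`.
  have hG : (√(2 * r : ℕ) + Real.log s * √Λ) ^ 2 ≤ 4 * l + 130 * M := by
    have h1 : √((2 * r : ℕ) : ℝ) ^ 2 = 2 * r := by
      rw [Real.sq_sqrt (Nat.cast_nonneg _)]; push_cast; ring
    have h2 : (Real.log s * √Λ) ^ 2 = M := by
      rw [mul_pow, Real.sq_sqrt (by linarith)]
    nlinarith [sq_nonneg (√((2 * r : ℕ) : ℝ) - Real.log s * √Λ)]
  have hbound : s * K ^ 2 * (10 ^ 15 * (4 * l + 130 * M)) ≤ 134 * (delta ^ 2 * m) := by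
    unfold SampleCondition at hsamp
    have hsamp' : s * K ^ 2 * max (10 ^ 15 * Real.log s ^ 2 * Real.log m * Real.log N)
        (10 ^ 15 * l) ≤ delta ^ 2 * m := by
      have := mul_le_mul_of_nonneg_left hsamp (by positivity : 0 ≤ delta ^ 2)
      refine le_trans (le_of_eq ?_) this
      rw [hl]
      generalize (max _ _ : ℝ) = z
      field_simp
    have h0 : (0 : ℝ) ≤ s * K ^ 2 := by positivity
    have h1 := (mul_le_mul_of_nonneg_left (le_max_left
      (10 ^ 15 * Real.log s ^ 2 * Real.log m * Real.log N) (10 ^ 15 * l)) h0).trans hsamp'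
    have h2 := (mul_le_mul_of_nonneg_left (le_max_right
      (10 ^ 15 * Real.log s ^ 2 * Real.log m * Real.log N) (10 ^ 15 * l)) h0).trans hsamp'
    have e : 10 ^ 15 * Real.log s ^ 2 * Real.log m * Real.log N = 10 ^ 15 * M := by
      rw [hM, hΛ]; ring
    rw [e] at h1
    linarith
  set D : Ω → ℝ := fun ω => deviation K y (fun i => X i ω) / m with hD
  have hDm : Measurable D :=
    (measurable_deviation.comp (measurable_pi_lambda _ hX)).div_const _
  have hD0 : ∀ ω, 0 ≤ D ω := fun ω => div_nonneg (deviation_nonneg _) hm'.le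
  -- With `β = δ²/216`, division by `(δ/2)^(2r)` leaves `4 · 27⁻ʳ`, which is at most `3⁻ʳ ≤ η`. The
  -- constant `10^15` is chosen to exceed `162000² · 134 · 216`.
  have hmom : ∫ ω, D ω ^ (2 * r) ∂P ≤ 4 * (2 * (delta ^ 2 / 216)) ^ r := by
    refine integral_deviation_pow_le hm hN hs hK hy hcard hX hind hmean hr1 ?_ (by nlinarith)
    have h0 : (0 : ℝ) ≤ s * K ^ 2 := by positivity
    calc _ ≤ 162000 ^ 2 * (s * K ^ 2) * (4 * l + 130 * M) := by gcongr
      _ ≤ _ := by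
        have : 0 ≤ delta ^ 2 * m := by positivity
        linarith
  have hint : Integrable (fun ω => D ω ^ (2 * r)) P :=
    integrable_pow_of_mem_Icc hDm (b := m * ((K * √s) ^ 2 + 1) / m)
      (fun ω => ⟨hD0 ω, div_le_div_of_nonneg_right (deviation_le hK.le hy _) hm'.le⟩) _
  have hmarkov := mul_meas_ge_le_integral_of_nonneg
    (Filter.Eventually.of_forall fun ω => pow_nonneg (hD0 ω) (2 * r)) hint ((delta / 2) ^ (2 * r))
  have hsub : {ω | delta / 2 ≤ D ω} ⊆ {ω | (delta / 2) ^ (2 * r) ≤ D ω ^ (2 * r)} := fun ω hω =>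
    pow_le_pow_left₀ (by positivity : 0 ≤ delta / 2) hω _
  have hpos : 0 < (delta / 2) ^ (2 * r) := by positivity
  have hreal : P.real {ω | delta / 2 ≤ D ω} ≤ eta := by
    have h1 : P.real {ω | delta / 2 ≤ D ω} ≤
        P.real {ω | (delta / 2) ^ (2 * r) ≤ D ω ^ (2 * r)} := measureReal_mono hsub
    have h2 : (delta / 2) ^ (2 * r) * P.real {ω | delta / 2 ≤ D ω} ≤
        (delta / 2) ^ (2 * r) * (4 * (27⁻¹) ^ r) := by
      refine ((mul_le_mul_of_nonneg_left h1 hpos.le).trans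
        (hmarkov.trans hmom)).trans (le_of_eq ?_)
      rw [pow_mul, mul_left_comm, ← mul_pow]
      congr 2
      ring
    have h3 := le_of_mul_le_mul_left h2 hpos
    refine h3.trans ?_
    have h4 : (4 : ℝ) ≤ 9 ^ r := by
      calc (4 : ℝ) ≤ 9 ^ 1 := by norm_num
        _ ≤ 9 ^ r := pow_le_pow_right₀ (by norm_num) hr1
    have h5 : eta⁻¹ ≤ 3 ^ r := by
      calc eta⁻¹ = Real.exp l := (Real.exp_log (by positivity)).symm
        _ ≤ Real.exp (r * 1) := Real.exp_le_exp.2 (by linarith)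
        _ = Real.exp 1 ^ r := Real.exp_nat_mul _ _
        _ ≤ 3 ^ r := pow_le_pow_left₀ (Real.exp_pos _).le (by linarith [Real.exp_one_lt_d9]) r
    have h6 : ((27 : ℝ)⁻¹) ^ r = (9 ^ r)⁻¹ * (3 ^ r)⁻¹ := by
      rw [← inv_pow, ← inv_pow, ← mul_pow]; norm_num
    rw [h6, ← mul_assoc]
    calc 4 * ((9 : ℝ) ^ r)⁻¹ * (3 ^ r)⁻¹ ≤ 1 * (3 ^ r)⁻¹ := by
          gcongr
          rw [← div_eq_mul_inv, div_le_one (by positivity)]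
          exact h4
      _ ≤ eta := by
          rw [one_mul]
          exact inv_le_of_inv_le₀ he h5
  rw [← ofReal_measureReal]
  exact ENNReal.ofReal_le_ofReal hreal

end Moments

/-! ### From the net to the restricted isometry constant -/

section RestrictedIsometry

variable {m N s : ℕ} {K : ℝ}

lemma norm_sq_normalizedRows_mulVec (v : Fin m → EuclideanSpace ℂ (Fin N))
    (x : EuclideanSpace ℂ (Fin N)) :
    ‖WithLp.toLp 2 (normalizedRows v *ᵥ x.ofLp)‖ ^ 2 =
      (∑ i, ‖(v i).ofLp ⬝ᵥ x.ofLp‖ ^ 2) / m := by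
  rw [EuclideanSpace.norm_sq_eq, Finset.sum_div]
  refine Finset.sum_congr rfl fun i _ => ?_
  have e : (normalizedRows v *ᵥ x.ofLp) i = (1 / (√(m : ℝ) : ℂ)) * ((v i).ofLp ⬝ᵥ x.ofLp) := by
    simp only [Matrix.mulVec, dotProduct, normalizedRows, Matrix.of_apply, Finset.mul_sum]
    exact Finset.sum_congr rfl fun _ _ => by ring
  simp only [e, norm_mul, norm_div, norm_one, Complex.norm_real, Real.norm_eq_abs,
    abs_of_nonneg (Real.sqrt_nonneg _), mul_pow, div_pow, Real.sq_sqrt (Nat.cast_nonneg m)]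
  ring

/-- It suffices to check the restricted isometry inequalities on unit vectors. -/
lemma ripBound_of_unit {A : Matrix (Fin m) (Fin N) ℂ} {d : ℝ}
    (h : ∀ x : EuclideanSpace ℂ (Fin N), hammingNorm x.ofLp ≤ s → ‖x‖ = 1 →
      |‖WithLp.toLp 2 (A *ᵥ x.ofLp)‖ ^ 2 - 1| ≤ d) : RIPBound s A d := by
  intro x hx
  rcases eq_or_ne x 0 with rfl | h0
  · simp
  have hn : 0 < ‖x‖ := norm_pos_iff.2 h0
  set c : ℂ := (‖x‖ : ℂ)⁻¹ with hc
  have hc0 : c ≠ 0 := inv_ne_zero (by exact_mod_cast hn.ne')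
  have hcn : ‖c‖ = ‖x‖⁻¹ := by rw [hc, norm_inv, Complex.norm_real, norm_norm]
  have h1 := h (c • x) (by
    refine le_trans (le_of_eq ?_) hx
    exact hammingNorm_smul (fun _ => IsSMulRegular.of_ne_zero hc0) _) (by
    rw [norm_smul, hcn, inv_mul_cancel₀ hn.ne'])
  rw [WithLp.ofLp_smul, Matrix.mulVec_smul, WithLp.toLp_smul, norm_smul, hcn, mul_pow, inv_pow,
    inv_mul_eq_div] at h1
  obtain ⟨h2, h3⟩ := abs_le.1 h1
  have hn2 : 0 < ‖x‖ ^ 2 := by positivity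
  constructor
  · rw [← le_div_iff₀ hn2]; linarith
  · rw [← div_le_iff₀ hn2]; linarith

lemma norm_le_sum_norm_coord (x : EuclideanSpace ℂ (Fin N)) : ‖x‖ ≤ ∑ j, ‖x j‖ := by
  rw [EuclideanSpace.norm_eq, Real.sqrt_le_left (Finset.sum_nonneg fun _ _ => norm_nonneg _)]
  exact Finset.sum_sq_le_sq_sum_of_nonneg fun _ _ => norm_nonneg _

lemma abs_norm_sq_sub_le {E : Type*} [SeminormedAddCommGroup E] {a b : E} {u B : ℝ}
    (hab : ‖a - b‖ ≤ u) (ha : ‖a‖ ≤ B) (hb : ‖b‖ ≤ B) : |‖a‖ ^ 2 - ‖b‖ ^ 2| ≤ 2 * B * u := by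
  have h1 : |‖a‖ - ‖b‖| ≤ u := (abs_norm_sub_norm_le a b).trans hab
  have h2 : ‖a‖ ^ 2 - ‖b‖ ^ 2 = (‖a‖ + ‖b‖) * (‖a‖ - ‖b‖) := by ring
  rw [h2, abs_mul, abs_of_nonneg (by positivity)]
  exact mul_le_mul (by linarith) h1 (abs_nonneg _) (by linarith [norm_nonneg a])

/-- Passing from a net to all sparse vectors. -/
lemma ricConst_lt_of_deviation_lt {ι : Type*} [Finite ι] {y : ι → EuclideanSpace ℂ (Fin N)}
    (hm : 2 ≤ m) (hs : 2 ≤ s) (hK : 1 ≤ K) (hy : ∀ j, y j ∈ sparseBall N s) {h delta : ℝ}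
    (hnet : ∀ x ∈ sparseBall N s, ∃ j, ∑ l, ‖x l - y j l‖ ≤ h)
    (hh : 16 * (s * K ^ 2 * h) ≤ delta) (hd : 0 < delta)
    {v : Fin m → EuclideanSpace ℂ (Fin N)} (hv : ∀ i j, ‖v i j‖ ≤ K)
    (hdev : deviation K y v / m < delta / 2) : ricConst s (normalizedRows v) < delta := by
  have hm' : (0 : ℝ) < m := by exact_mod_cast (by omega : 0 < m)
  have hs' : (2 : ℝ) ≤ s := by exact_mod_cast hs
  -- The deviation on the net costs `δ/2`. Moving from `x` to the net costs at most `2sK²h + 2h ≤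
  -- 4sK²h ≤ δ/4`. The total stays strictly below `δ`.
  suffices hrip : RIPBound s (normalizedRows v) (3 / 4 * delta) by
    refine lt_of_le_of_lt ((ricConst_isLeast s (normalizedRows v)).2 ⟨by positivity, hrip⟩) ?_
    linarith
  refine ripBound_of_unit fun x hx hx1 => ?_
  have hxs : x ∈ sparseBall N s := ⟨hx, hx1.le⟩
  obtain ⟨j, hj⟩ := hnet x hxs
  have hh0 : 0 ≤ h := (Finset.sum_nonneg fun _ _ => norm_nonneg _).trans hj
  have hK0 : 0 ≤ K := by linarith
  have hsq : √(s : ℝ) ≤ s := by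
    rw [Real.sqrt_le_left (by linarith)]
    nlinarith
  have hdot : ∀ i, ∀ z ∈ sparseBall N s, ‖(v i).ofLp ⬝ᵥ z.ofLp‖ ≤ K * s := fun i z hz =>
    (norm_dotProduct_le (hv i) _).trans (mul_le_mul_of_nonneg_left
      ((sum_norm_le_of_mem_sparseBall hz).trans hsq) hK0)
  have h1 : ∀ i, |‖(v i).ofLp ⬝ᵥ x.ofLp‖ ^ 2 - ‖(v i).ofLp ⬝ᵥ (y j).ofLp‖ ^ 2| ≤
      2 * (K * s) * (K * h) := by
    intro i
    refine abs_norm_sq_sub_le ?_ (hdot i x hxs) (hdot i _ (hy j))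
    rw [← dotProduct_sub]
    exact (norm_dotProduct_le (hv i) _).trans (mul_le_mul_of_nonneg_left hj hK0)
  have h2 : |‖x‖ ^ 2 - ‖y j‖ ^ 2| ≤ 2 * 1 * h :=
    abs_norm_sq_sub_le ((norm_le_sum_norm_coord _).trans hj) hx1.le (hy j).2
  have h3 : |∑ i, ‖(v i).ofLp ⬝ᵥ (y j).ofLp‖ ^ 2 - m * ‖y j‖ ^ 2| < delta / 2 * m := by
    rw [div_lt_iff₀ hm'] at hdev
    refine lt_of_le_of_lt ?_ hdev
    have := abs_sub_le_deviation (K := K) (y := y) v j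
    simpa only [energy, boundedPart_of_le (hv _)] using this
  have h4 : |∑ i, ‖(v i).ofLp ⬝ᵥ x.ofLp‖ ^ 2 - ∑ i, ‖(v i).ofLp ⬝ᵥ (y j).ofLp‖ ^ 2| ≤
      m * (2 * (K * s) * (K * h)) := by
    rw [← Finset.sum_sub_distrib]
    refine (Finset.abs_sum_le_sum_abs _ _).trans ((Finset.sum_le_sum fun i _ => h1 i).trans ?_)
    simp
  rw [norm_sq_normalizedRows_mulVec]
  have e : (∑ i, ‖(v i).ofLp ⬝ᵥ x.ofLp‖ ^ 2) / m - 1 =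
      (∑ i, ‖(v i).ofLp ⬝ᵥ x.ofLp‖ ^ 2 - m) / m := by field_simp
  rw [e, abs_div, abs_of_pos hm', div_le_iff₀ hm']
  rw [hx1] at h2
  have hhK : h ≤ s * K ^ 2 * h := by
    have : 1 ≤ s * K ^ 2 := by nlinarith
    nlinarith
  have hmh : m * (16 * (s * K ^ 2 * h)) ≤ m * delta := by gcongr
  have hmh2 : m * h ≤ m * (s * K ^ 2 * h) := by gcongr
  have h5 : m * |1 ^ 2 - ‖y j‖ ^ 2| ≤ m * (2 * 1 * h) := by gcongr
  rw [← abs_of_pos hm', ← abs_mul, abs_of_pos hm'] at h5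
  have e2 : m * (2 * (K * s) * (K * h)) = 2 * (m * (s * K ^ 2 * h)) := by ring
  rw [e2] at h4
  obtain ⟨a1, a2⟩ := abs_le.1 h4
  obtain ⟨b1, b2⟩ := abs_le.1 h5
  obtain ⟨c1, c2⟩ := abs_lt.1 h3
  refine abs_le.2 ⟨?_, ?_⟩ <;> nlinarith

/-- The inner product conjugates `v`, whereas a matrix row acts without conjugation. Conjugating `x`
mediates between them and is harmless, since isotropy is assumed for all vectors. -/
lemma norm_inner_conj_eq (v x : EuclideanSpace ℂ (Fin N)) :
    ‖inner ℂ v (WithLp.toLp 2 (star x.ofLp))‖ = ‖v.ofLp ⬝ᵥ x.ofLp‖ := by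
  have : inner ℂ v (WithLp.toLp 2 (star x.ofLp)) = star (v.ofLp ⬝ᵥ x.ofLp) := by
    simp only [PiLp.inner_apply, dotProduct, star_sum, star_mul', Pi.star_apply]
    refine Finset.sum_congr rfl fun i _ => ?_
    simp [mul_comm]
  rw [this, norm_star]

lemma norm_toLp_star (x : EuclideanSpace ℂ (Fin N)) :
    ‖WithLp.toLp 2 (star x.ofLp)‖ = ‖x‖ := by
  simp [EuclideanSpace.norm_eq]

variable {Ω : Type*} [MeasurableSpace Ω] {P : Measure Ω} [IsProbabilityMeasure P]
  {X : Fin m → Ω → EuclideanSpace ℂ (Fin N)}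

/-- Isotropy on average forces the bound on the entries to be at least one. -/
lemma one_le_of_isotropic (hm : 2 ≤ m) (hN : 2 ≤ N)
    (hiso : ∀ x : EuclideanSpace ℂ (Fin N),
      (1 / (m : ℝ)) * ∑ i, ∫ ω, ‖inner ℂ (X i ω) x‖ ^ 2 ∂P = ‖x‖ ^ 2)
    (hbdd : ∀ i, ∀ᵐ ω ∂P, ∀ j, ‖X i ω j‖ ≤ K) : 1 ≤ K := by
  have hm' : (0 : ℝ) < m := by exact_mod_cast (by omega : 0 < m)
  have hK0 : 0 ≤ K := by
    obtain ⟨ω, hω⟩ := (hbdd ⟨0, by omega⟩).exists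
    exact (norm_nonneg _).trans (hω ⟨0, by omega⟩)
  have h1 := hiso (EuclideanSpace.single ⟨0, by omega⟩ 1)
  have h2 : ∀ i, ∫ ω, ‖inner ℂ (X i ω) (EuclideanSpace.single ⟨0, by omega⟩ (1 : ℂ))‖ ^ 2 ∂P ≤
      K ^ 2 := by
    intro i
    calc _ ≤ ∫ _ω, K ^ 2 ∂P := by
          refine integral_mono_of_nonneg (Filter.Eventually.of_forall fun ω => by positivity)
            (integrable_const _) ?_
          filter_upwards [hbdd i] with ω hω
          simp only [EuclideanSpace.inner_single_right, one_mul, RCLike.norm_conj]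
          exact pow_le_pow_left₀ (norm_nonneg _) (hω _) 2
      _ = K ^ 2 := by simp
  have h3 : (1 / (m : ℝ)) * ∑ i, ∫ ω, ‖inner ℂ (X i ω)
      (EuclideanSpace.single ⟨0, by omega⟩ (1 : ℂ))‖ ^ 2 ∂P ≤ (1 / (m : ℝ)) * (m * K ^ 2) := by
    gcongr
    refine (Finset.sum_le_sum fun i _ => h2 i).trans (le_of_eq ?_)
    simp
  rw [h1] at h3
  have e : (1 / (m : ℝ)) * (m * K ^ 2) = K ^ 2 := by field_simp
  rw [e, PiLp.norm_single, norm_one] at h3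
  nlinarith

lemma sum_integral_energy {Ω : Type*} [MeasurableSpace Ω] {P : Measure Ω}
    {X : Fin m → Ω → EuclideanSpace ℂ (Fin N)} (hm : 2 ≤ m)
    (hiso : ∀ x : EuclideanSpace ℂ (Fin N),
      (1 / (m : ℝ)) * ∑ i, ∫ ω, ‖inner ℂ (X i ω) x‖ ^ 2 ∂P = ‖x‖ ^ 2)
    (hbdd : ∀ i, ∀ᵐ ω ∂P, ∀ j, ‖X i ω j‖ ≤ K) (x : EuclideanSpace ℂ (Fin N)) :
    ∑ i, ∫ ω, energy K x (X i ω) ∂P = m * ‖x‖ ^ 2 := by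
  have hm' : (0 : ℝ) < m := by exact_mod_cast (by omega : 0 < m)
  have h := hiso (WithLp.toLp 2 (star x.ofLp))
  rw [norm_toLp_star] at h
  rw [← h, ← mul_assoc, mul_one_div_cancel hm'.ne', one_mul]
  refine Finset.sum_congr rfl fun i _ => integral_congr_ae ?_
  filter_upwards [hbdd i] with ω hω
  rw [norm_inner_conj_eq, energy, boundedPart_of_le hω]

lemma le_of_sampleCondition {delta eta : ℝ} (hm : 2 ≤ m) (hN : 2 ≤ N) (hs : 2 ≤ s)
    (hd : 0 < delta) (hsamp : SampleCondition (10 ^ 15) (10 ^ 15) m N s K delta eta) :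
    s * K ^ 2 ≤ delta ^ 2 * m := by
  have hlm := half_le_log hm
  have hlN := half_le_log hN
  have hls := half_le_log hs
  have h1 : 1 ≤ 10 ^ 15 * Real.log s ^ 2 * Real.log m * Real.log N := by
    calc (1 : ℝ) ≤ 10 ^ 15 * (1 / 2) ^ 2 * (1 / 2) * (1 / 2) := by norm_num
      _ ≤ _ := by gcongr
  have h2 : s * K ^ 2 * (delta ^ 2)⁻¹ * 1 ≤ m := by
    refine le_trans ?_ hsamp
    gcongr
    exact h1.trans (le_max_left _ _)
  rw [mul_one, ← div_eq_mul_inv, div_le_iff₀ (by positivity)] at h2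
  linarith

/-- The mesh is polynomial in `m`, so each of the `s` positions costs `log N + O(log m)`; both terms
are dominated by `log m * log N` since the logarithms are at least `1/2`. -/
lemma card_net_le (hm : 2 ≤ m) (hN : 2 ≤ N) :
    (Fintype.card (Fin s → Fin N × Fin (2 * (32 * m ^ 2) + 1) × Fin (2 * (32 * m ^ 2) + 1)) : ℝ) ≤
      Real.exp (100 * s * (Real.log m * Real.log N)) := by
  have hm' : (2 : ℝ) ≤ m := by exact_mod_cast hm
  have hN' : (2 : ℝ) ≤ N := by exact_mod_cast hN
  have hlm := half_le_log hm
  have hlN := half_le_log hN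
  set R : ℝ := 2 * (32 * m ^ 2) + 1 with hR
  have hR0 : 0 < R := by positivity
  have e : (Fintype.card (Fin s → Fin N × Fin (2 * (32 * m ^ 2) + 1) ×
      Fin (2 * (32 * m ^ 2) + 1)) : ℝ) = Real.exp (s * (Real.log N + 2 * Real.log R)) := by
    rw [Real.exp_nat_mul, Real.exp_add, Real.exp_log (by positivity), two_mul (Real.log R), Real.exp_add,
      Real.exp_log hR0]
    simp [hR]
  have h1 : Real.log R ≤ (9 : ℕ) * Real.log m := by
    refine log_le_mul_log hR0 ?_
    have h7 : (2 : ℝ) ^ 7 ≤ m ^ 7 := by gcongr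
    have h2 : (2 : ℝ) ^ 2 ≤ m ^ 2 := by gcongr
    have : (m : ℝ) ^ 9 = m ^ 7 * m ^ 2 := by ring
    rw [this, hR]
    nlinarith
  rw [e, Real.exp_le_exp]
  push_cast at h1
  have h2 : Real.log N + 2 * Real.log R ≤ 100 * (Real.log m * Real.log N) := by nlinarith
  calc s * (Real.log N + 2 * Real.log R) ≤ s * (100 * (Real.log m * Real.log N)) := by gcongr
    _ = _ := by ring

/-- Restricted isometry constants of random matrices with independent bounded rows. -/
lemma measure_ricConst_ge_le {delta eta : ℝ} (hm : 2 ≤ m) (hN : 2 ≤ N) (hs : 2 ≤ s)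
    (hd : 0 < delta) (hd1 : delta < 1) (he : 0 < eta) (he1 : eta < 1)
    (hsamp : SampleCondition (10 ^ 15) (10 ^ 15) m N s K delta eta)
    (hX : ∀ i, Measurable (X i)) (hind : iIndepFun X P)
    (hiso : ∀ x : EuclideanSpace ℂ (Fin N),
      (1 / (m : ℝ)) * ∑ i, ∫ ω, ‖inner ℂ (X i ω) x‖ ^ 2 ∂P = ‖x‖ ^ 2)
    (hbdd : ∀ i, ∀ᵐ ω ∂P, ∀ j, ‖X i ω j‖ ≤ K) :
    P {ω | delta ≤ ricConst s (normalizedRows fun i => X i ω)} ≤ ENNReal.ofReal eta := by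
  have hm' : (2 : ℝ) ≤ m := by exact_mod_cast hm
  have hs' : (2 : ℝ) ≤ s := by exact_mod_cast hs
  have hK : 1 ≤ K := one_le_of_isotropic hm hN hiso hbdd
  have hsK := le_of_sampleCondition hm hN hs hd hsamp
  -- This mesh gives ℓ₁-distance `s/(16m²)`, so the net error condition reads `s · sK² ≤ δm²`; it
  -- follows from `sK² ≤ δ²m` and `s ≤ m`, the latter because `K ≥ 1`.
  obtain ⟨y, hy, hnet⟩ := exists_sparse_net (N := N) (s := s) (R := 32 * m ^ 2) (by omega)
    (by positivity)
  have hne : Nonempty (Fin s → Fin N × Fin (2 * (32 * m ^ 2) + 1) ×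
      Fin (2 * (32 * m ^ 2) + 1)) := ⟨fun _ => (⟨0, by omega⟩, 0, 0)⟩
  -- Almost surely the truncation in `energy` is inactive and the event is contained in the
  -- deviation event; monotonicity of the measure requires no measurability of `ricConst`.
  refine le_trans (measure_mono_ae ?_) (measure_deviation_ge_le hm hN hs (by linarith) hy
    (card_net_le hm hN) hX hind (fun j => sum_integral_energy hm hiso hbdd (y j)) hd hd1 he he1
    hsamp)
  filter_upwards [ae_all_iff.2 hbdd] with ω hω hric
  by_contra hlt
  refine absurd (ricConst_lt_of_deviation_lt hm hs hK hy hnet ?_ hd hω (not_le.1 hlt))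
    (not_lt.2 hric)
  have h1 : s * (s * K ^ 2) ≤ delta * m ^ 2 := by
    have h2 : (s : ℝ) ≤ m := by
      have : (s : ℝ) * 1 ≤ s * K ^ 2 := by gcongr; nlinarith
      have : delta ^ 2 * m ≤ 1 * m := by gcongr; nlinarith
      linarith
    calc s * (s * K ^ 2) ≤ m * (delta ^ 2 * m) := by gcongr
      _ ≤ m * (delta * m) := by gcongr; nlinarith
      _ = _ := by ring
  push_cast
  have e : 16 * (s * K ^ 2 * (2 * s / (32 * m ^ 2))) = s * (s * K ^ 2) / (m : ℝ) ^ 2 := by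
    field_simp
    norm_num
  rw [e, div_le_iff₀ (by positivity)]
  exact h1

end RestrictedIsometry

/-! ### Bounded orthonormal systems and the main theorem -/

lemma IsBoundedOrthonormalSystem.integral_norm_sq {D : Type*} [MeasurableSpace D] {ν : Measure D}
    [IsProbabilityMeasure ν] {N : ℕ} {φ : Fin N → D → ℂ} {K : ℝ}
    (h : IsBoundedOrthonormalSystem ν φ K) (x : EuclideanSpace ℂ (Fin N)) :
    ∫ t, ‖inner ℂ (WithLp.toLp 2 fun j => φ j t) x‖ ^ 2 ∂ν = ‖x‖ ^ 2 := by
  have hint : ∀ j k, Integrable (fun t => φ j t * starRingEnd ℂ (φ k t)) ν := by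
    intro j k
    refine Integrable.of_bound ((h.measurable j).mul
      (Complex.continuous_conj.measurable.comp (h.measurable k))).aestronglyMeasurable (K * K) ?_
    filter_upwards [h.bounded j, h.bounded k] with t h1 h2
    rw [norm_mul, RCLike.norm_conj]
    exact mul_le_mul h1 h2 (norm_nonneg _) ((norm_nonneg _).trans h1)
  have hexp : ∀ t, ((‖inner ℂ (WithLp.toLp 2 fun j => φ j t) x‖ ^ 2 : ℝ) : ℂ) =
      ∑ j, ∑ k, (starRingEnd ℂ (x j) * x k) * (φ j t * starRingEnd ℂ (φ k t)) := by
    intro t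
    have e : inner ℂ (WithLp.toLp 2 fun j => φ j t) x =
        ∑ k, x k * starRingEnd ℂ (φ k t) := by
      simp [PiLp.inner_apply]
    rw [e, Complex.ofReal_pow, ← Complex.conj_mul', map_sum, Finset.sum_mul_sum]
    refine Finset.sum_congr rfl fun j _ => Finset.sum_congr rfl fun k _ => ?_
    simp only [map_mul, Complex.conj_conj]
    ring
  have hC : ((∫ t, ‖inner ℂ (WithLp.toLp 2 fun j => φ j t) x‖ ^ 2 ∂ν : ℝ) : ℂ) =
      ((‖x‖ ^ 2 : ℝ) : ℂ) := by
    rw [← integral_complex_ofReal]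
    simp_rw [hexp]
    rw [integral_finsetSum _ fun j _ => integrable_finsetSum _ fun k _ => (hint j k).const_mul _]
    simp_rw [integral_finsetSum Finset.univ fun k _ => (hint _ k).const_mul _,
      integral_const_mul, h.orthonormal]
    rw [EuclideanSpace.norm_sq_eq, Complex.ofReal_sum]
    refine Finset.sum_congr rfl fun j _ => ?_
    simp [Complex.conj_mul']
  exact_mod_cast hC

/-- Restricted isometry constants of random matrices with independent, uniformly bounded rows that
are isotropic on average; the second part is the case of rows sampled from a bounded orthonormal
system. The constants `d₁, d₂` are universal. -/
theorem theorem4p2 :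
    ∃ d₁ d₂ : ℝ, 0 < d₁ ∧ 0 < d₂ ∧
      ∀ (Ω : Type*) [MeasurableSpace Ω] (P : Measure Ω) [IsProbabilityMeasure P]
        (m N s : ℕ) (K delta eta : ℝ), 2 ≤ m → 2 ≤ N → 2 ≤ s →
        0 < delta → delta < 1 → 0 < eta → eta < 1 →
        SampleCondition d₁ d₂ m N s K delta eta →
        (∀ X : Fin m → Ω → EuclideanSpace ℂ (Fin N),
            (∀ i, Measurable (X i)) →
            iIndepFun X P →
            (∀ x : EuclideanSpace ℂ (Fin N),
              (1 / (m : ℝ)) * ∑ i, ∫ ω, ‖inner ℂ (X i ω) x‖ ^ 2 ∂P = ‖x‖ ^ 2) →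
            (∀ i, ∀ᵐ ω ∂P, ∀ j, ‖X i ω j‖ ≤ K) →
            P {ω | delta ≤ ricConst s (normalizedRows fun i => X i ω)} ≤ ENNReal.ofReal eta) ∧
        (∀ (D : Type*) [MeasurableSpace D] (ν : Measure D) [IsProbabilityMeasure ν]
            (φ : Fin N → D → ℂ) (t : Fin m → Ω → D),
            IsBoundedOrthonormalSystem ν φ K →
            (∀ i, Measurable (t i)) →
            iIndepFun t P →
            (∀ i, P.map (t i) = ν) →
            P {ω | delta ≤ ricConst s
                (normalizedRows fun i => WithLp.toLp 2 fun j => φ j (t i ω))} ≤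
              ENNReal.ofReal eta) := by
  refine ⟨10 ^ 15, 10 ^ 15, by norm_num, by norm_num, ?_⟩
  intro Ω _ P _ m N s K delta eta hm hN hs hd hd1 he he1 hsamp
  refine ⟨fun X hX hind hiso hbdd =>
    measure_ricConst_ge_le hm hN hs hd hd1 he he1 hsamp hX hind hiso hbdd, ?_⟩
  intro D _ ν _ φ t hφ ht hind hlaw
  have hmeas : Measurable fun d => WithLp.toLp 2 fun j => φ j d :=
    (WithLp.measurable_toLp 2 _).comp (measurable_pi_lambda _ hφ.measurable)
  have hm' : (m : ℝ) ≠ 0 := by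
    have : m ≠ 0 := by omega
    exact_mod_cast this
  refine measure_ricConst_ge_le (X := fun i ω => WithLp.toLp 2 fun j => φ j (t i ω))
    hm hN hs hd hd1 he he1 hsamp (fun i => hmeas.comp (ht i))
    (hind.comp (fun _ d => WithLp.toLp 2 fun j => φ j d) fun _ => hmeas) (fun x => ?_) fun i => ?_
  · have h1 : ∀ i, ∫ ω, ‖inner ℂ (WithLp.toLp 2 fun j => φ j (t i ω)) x‖ ^ 2 ∂P = ‖x‖ ^ 2 := by
      intro i
      rw [← hφ.integral_norm_sq x, ← hlaw i]
      have h0 : Measurable fun d => ‖inner ℂ (WithLp.toLp 2 fun j => φ j d) x‖ ^ 2 :=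
        (hmeas.inner_const (𝕜 := ℂ)).norm.pow_const 2
      exact (integral_map (ht i).aemeasurable h0.aestronglyMeasurable).symm
    simp only [h1, Finset.sum_const, Finset.card_univ, Fintype.card_fin, nsmul_eq_mul]
    field_simp
  · have h2 : ∀ᵐ d ∂(P.map (t i)), ∀ j, ‖φ j d‖ ≤ K := by
      rw [hlaw i]
      exact ae_all_iff.2 hφ.bounded
    exact ae_of_ae_map (ht i).aemeasurable h2
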